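/- For an integer $n\ge 1$, a symmetric matrix $W\in M_n(\mathbb R)$ with non-negative coefficients and $\eta\in[0,\infty)^n$, let $\nu_n^{W,\eta}$ be the probability measure on $(0,\infty)^n$ (the law of the $\beta$-field) with density $$\left(\tfrac{2}{\pi}\right)^{n/2}\exp\left(-\tfrac12\left(\langle 1_n,H_\beta 1_n\rangle+\langle\eta,H_\beta^{-1}\eta\rangle-2\sum_{i=1}^n\eta_i\right)\right)\frac{1}{\sqrt{\det H_\beta}}\,\mathbf 1_{\{H_\beta>0\}}$$ with respect to $d\beta_1\cdots d\beta_n$, where $1_n=(1,\dots,1)$, $H_\beta(i,i)=2\beta_i-W(i,i)$, $H_\beta(i,j)=-W(i,j)$ for $i\ne j$, and $H_\beta>0$ means that $H_\beta$ is positive definite. Let $\tilde\nu_n^{W,\eta}$ be the law of the random matrix $H_\beta$ when $\beta$ has law $\nu_n^{W,\eta}$. Let $n\ge 2$ and let $W^-,W^+\in M_n(\mathbb R)$ be symmetric matrices with zero diagonal and non-negative off-diagonal coefficients such that $W^-(i,j)\le W^+(i,j)$ for all $i,j$, and such that any two indices $i,j$ are $W^-$-connected, i.e. there is a finite sequence $k_1=i,k_2,\dots,k_m=j$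 with $W^-(k_a,k_{a+1})\ne 0$ for all $1\le a\le m-1$. Let $H^-$ and $H^+$ be random matrices with laws $\tilde\nu_n^{W^-,0}$ and $\tilde\nu_n^{W^+,0}$, and let $G^-$ and $G^+$ be their inverses. Then for every convex function $f:[0,\infty)\to\mathbb R$, every index $i\in\{1,\dots,n\}$ and every deterministic vector $X\in[0,\infty)^n$, $$\mathbb E\left[f\left(\frac{\sum_{j=1}^n X_jG^-(i,j)}{G^-(i,i)}\right)\right]\ \ge\ \mathbb E\left[f\left(\frac{\sum_{j=1}^n X_jG^+(i,j)}{G^+(i,i)}\right)\right],$$ where both expectations are well defined in $(-\infty,+\infty]$ (the negative parts are integrable). -/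

import Mathlib

open MeasureTheory ProbabilityTheory
open scoped ENNReal Matrix

noncomputable section

namespace BetaField

/-- Real matrices carry the product (Borel) sigma-algebra of their entries. -/
instance instMeasurableSpaceMatrix {m n : ℕ} :
    MeasurableSpace (Matrix (Fin m) (Fin n) ℝ) :=
  inferInstanceAs (MeasurableSpace (Fin m → Fin n → ℝ))

/-- The matrix `H_β`, with entries `H_β(i,i) = 2 β_i - W(i,i)` and `H_β(i,j) = -W(i,j)`
for `i ≠ j`. -/
def hMatrix {n : ℕ} (W : Matrix (Fin n) (Fin n) ℝ) (β : Fin n → ℝ) :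
    Matrix (Fin n) (Fin n) ℝ :=
  Matrix.of fun i j => if i = j then 2 * β i - W i i else -W i j

theorem measurable_hMatrix {n : ℕ} (W : Matrix (Fin n) (Fin n) ℝ) :
    Measurable (hMatrix W) := by
  refine measurable_pi_lambda (fun β i j => hMatrix W β i j) fun i =>
    measurable_pi_lambda _ fun j => ?_
  by_cases h : i = j
  · simp only [hMatrix, Matrix.of_apply, h, if_true]
    fun_prop
  · simp only [hMatrix, Matrix.of_apply, h, if_false]
    fun_prop

open Classical in
/-- The Lebesgue density of the β-field `ν_n^{W,η}`,
`(2/π)^{n/2} exp(-(1/2)(⟨1, H_β 1⟩ + ⟨η, H_β⁻¹ η⟩ - 2 ∑ η_i)) / √(det H_β)` on the set of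
`β ∈ (0,∞)^n` for which `H_β` is positive definite, and `0` elsewhere. -/
def betaDensity {n : ℕ} (W : Matrix (Fin n) (Fin n) ℝ) (η β : Fin n → ℝ) : ℝ :=
  if (∀ i, 0 < β i) ∧ (hMatrix W β).PosDef then
    (2 / Real.pi) ^ ((n : ℝ) / 2) *
      Real.exp (-(1 / 2) * ((1 : Fin n → ℝ) ⬝ᵥ (hMatrix W β *ᵥ 1)
        + η ⬝ᵥ ((hMatrix W β)⁻¹ *ᵥ η) - 2 * ∑ i, η i)) /
      Real.sqrt (hMatrix W β).det
  else 0

/-- The law `ν_n^{W,η}` of the β-field. -/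
def betaLaw {n : ℕ} (W : Matrix (Fin n) (Fin n) ℝ) (η : Fin n → ℝ) :
    Measure (Fin n → ℝ) :=
  (volume : Measure (Fin n → ℝ)).withDensity fun β => ENNReal.ofReal (betaDensity W η β)

/-- The law `ν̃_n^{W,η}` of the random matrix `H_β` when `β` has law `ν_n^{W,η}`. -/
def hLaw {n : ℕ} (W : Matrix (Fin n) (Fin n) ℝ) (η : Fin n → ℝ) :
    Measure (Matrix (Fin n) (Fin n) ℝ) :=
  (betaLaw W η).map (hMatrix W)

/-- `i` and `j` are `M`-connected: there is a finite sequence from `i` to `j` along which the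
successive entries of `M` do not vanish. -/
def Connected {n : ℕ} (M : Matrix (Fin n) (Fin n) ℝ) (i j : Fin n) : Prop :=
  Relation.ReflTransGen (fun a b => M a b ≠ 0) i j

/-- The ratio `(∑_j X_j G(i,j)) / G(i,i)`, where `G = H⁻¹`. -/
def ratio {n : ℕ} (H : Matrix (Fin n) (Fin n) ℝ) (X : Fin n → ℝ) (i : Fin n) : ℝ :=
  (∑ j, X j * H⁻¹ i j) / H⁻¹ i i

/-- The expectation of `Y` exists as an element of `(-∞, ∞]`: `Y` is almost everywhere
measurable and its negative part is integrable. -/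
def HasExpectation {Ω : Type*} [MeasurableSpace Ω] (P : Measure Ω) (Y : Ω → ℝ) : Prop :=
  AEMeasurable Y P ∧ ∫⁻ ω, ENNReal.ofReal (-Y ω) ∂P ≠ ∞

/-- The expectation `E(Y) = E(Y⁺) - E(Y⁻)` as an extended real number, meaningful when
`HasExpectation P Y`. -/
def expectation {Ω : Type*} [MeasurableSpace Ω] (P : Measure Ω) (Y : Ω → ℝ) : EReal :=
  ((∫⁻ ω, ENNReal.ofReal (Y ω) ∂P : ℝ≥0∞) : EReal) -
    ((∫⁻ ω, ENNReal.ofReal (-Y ω) ∂P : ℝ≥0∞) : EReal)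

end BetaField

end

/-!
The ratio `∑_j X_j G(i,j) / G(i,i)` does not depend on the diagonal entry of `H` at the root `i`.
When this entry is integrated out, the ratio becomes `X_i + ⟨X, ψ⟩` with `ψ = H⁻¹ η` on the other
vertices, where `η` is the vector of weights of the edges to the root and `H` follows the field
with boundary term `η` (`lintegral_hLaw_eq`). It suffices to raise one edge weight at a time, and
to show that the integral of a nonnegative convex function of `⟨X, ψ⟩` decreases.

Everything rests on the inverse Gaussian laws of mean `1`. Two densities of this family cross at
exactly two points and the one with the larger shape dominates between them. As masses and means
agree, a convex function may be replaced by its difference with the chord through the crossing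
points, and so its integral decreases as the shape increases (`igLintegral_anti`).

* An edge from the vertex `p` to the root. The law of the field away from `p` does not depend on
  `η_p`. Given this field, the Schur complement at `p` shows that `⟨X, ψ⟩` is a nondecreasing
  affine function of an inverse Gaussian variable of mean `1`, whose shape is `η_p` plus a term
  that does not depend on `η_p` (`fieldLintegral_vertex`).
* An edge between two vertices `a`, `b` other than the root. All other vertices are eliminated,
  which leaves effective weights `w`, `η_a`, `η_b` on the triangle formed by `a`, `b` and the
  root. In the coordinates `s = η_a ψ_a + η_b ψ_b` and `r = ψ_a / ψ_b`, the law of `s` does not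
  depend on `w`, and given `s` the variable `r` has, up to a constant, the inverse Gaussian
  density of shape `w + η_a η_b / s` times the factor `η_a r + η_b` (`lintegral_two_vertices`).
  With this factor a convex function of `(ψ_a, ψ_b) = s (r, 1) / (η_a r + η_b)` turns into its
  perspective, which is convex in `r`.

The elimination of a vertex also shows that the mass and the mean of `⟨X, ψ⟩` do not depend on the
weights (`fieldLintegral_affine`). A convex function on `[0, ∞)` of either sign is the difference
of a nonnegative one and of some `M (1 + z)`, so its expectation exists in `(-∞, ∞]`, and the
general case follows from the nonnegative one (`expectation_ratio`).
-/

noncomputable section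

namespace BetaField

/-! ### Elimination of one vertex -/

/-- The matrix with diagonal `h` and off-diagonal entries `-W i j`. When `W` has zero diagonal, this
is `H_β` in the coordinates `h = 2β`. The diagonal of `W` plays no role. -/
def opMatrix {m : ℕ} (W : Matrix (Fin m) (Fin m) ℝ) (h : Fin m → ℝ) : Matrix (Fin m) (Fin m) ℝ :=
  Matrix.of fun i j => if i = j then h i else -W i j

/-- The bilinear form `⟨X, H⁻¹ Y⟩` of the Green function of `H = opMatrix W h`. -/
def green {m : ℕ} (W : Matrix (Fin m) (Fin m) ℝ) (h X Y : Fin m → ℝ) : ℝ :=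
  X ⬝ᵥ ((opMatrix W h)⁻¹ *ᵥ Y)

/-- The weights of the graph with the vertex `p` removed. -/
def delWeight {m : ℕ} (W : Matrix (Fin (m + 1)) (Fin (m + 1)) ℝ) (p : Fin (m + 1)) :
    Matrix (Fin m) (Fin m) ℝ :=
  W.submatrix p.succAbove p.succAbove

/-- The weights of the edges between the vertex `p` and the remaining vertices. -/
def row {m : ℕ} (W : Matrix (Fin (m + 1)) (Fin (m + 1)) ℝ) (p : Fin (m + 1)) : Fin m → ℝ :=
  fun j => W p (p.succAbove j)

/-- The diagonal which is `h` away from `p` and for which the Schur complement of `opMatrix W` at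
`p` is `x`. -/
def schurDiag {m : ℕ} (W : Matrix (Fin (m + 1)) (Fin (m + 1)) ℝ) (p : Fin (m + 1)) (x : ℝ)
    (h : Fin m → ℝ) : Fin (m + 1) → ℝ :=
  p.insertNth (x + green (delWeight W p) h (row W p) (row W p)) h

variable {m : ℕ}

theorem opMatrix_isSymm {W : Matrix (Fin m) (Fin m) ℝ} (hW : W.IsSymm) (h : Fin m → ℝ) :
    (opMatrix W h).IsSymm := by
  ext i j
  by_cases hij : i = j
  · simp [hij]
  · simp [opMatrix, hij, Ne.symm hij, hW.apply i j]

theorem opMatrix_isHermitian {W : Matrix (Fin m) (Fin m) ℝ} (hW : W.IsSymm) (h : Fin m → ℝ) :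
    (opMatrix W h).IsHermitian := by
  rw [Matrix.IsHermitian, Matrix.conjTranspose_eq_transpose_of_trivial]
  exact opMatrix_isSymm hW h

theorem delWeight_isSymm {W : Matrix (Fin (m + 1)) (Fin (m + 1)) ℝ} (hW : W.IsSymm)
    (p : Fin (m + 1)) : (delWeight W p).IsSymm := hW.submatrix _

theorem green_comm {W : Matrix (Fin m) (Fin m) ℝ} (hW : W.IsSymm) (h X Y : Fin m → ℝ) :
    green W h X Y = green W h Y X := by
  have hs : ((opMatrix W h)⁻¹)ᵀ = (opMatrix W h)⁻¹ := by
    rw [Matrix.transpose_nonsing_inv, opMatrix_isSymm hW h]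
  rw [green, green, Matrix.dotProduct_mulVec, ← Matrix.mulVec_transpose, hs, dotProduct_comm]

theorem green_add_left (W : Matrix (Fin m) (Fin m) ℝ) (h X X' Y : Fin m → ℝ) :
    green W h (X + X') Y = green W h X Y + green W h X' Y := by
  simp [green, add_dotProduct]

theorem green_add_right (W : Matrix (Fin m) (Fin m) ℝ) (h X Y Y' : Fin m → ℝ) :
    green W h X (Y + Y') = green W h X Y + green W h X Y' := by
  simp [green, Matrix.mulVec_add, dotProduct_add]

@[simp]
theorem green_zero_left (W : Matrix (Fin m) (Fin m) ℝ) (h Y : Fin m → ℝ) : green W h 0 Y = 0 := by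
  simp [green]

@[simp]
theorem green_zero_right (W : Matrix (Fin m) (Fin m) ℝ) (h X : Fin m → ℝ) : green W h X 0 = 0 := by
  simp [green]

theorem single_comp_succAbove (p : Fin (m + 1)) (t : ℝ) :
    (Pi.single p t : Fin (m + 1) → ℝ) ∘ p.succAbove = 0 := by
  ext; simp

theorem green_single_left (W : Matrix (Fin m) (Fin m) ℝ) (h Y : Fin m → ℝ) (j : Fin m) :
    green W h (Pi.single j 1) Y = ((opMatrix W h)⁻¹ *ᵥ Y) j := by
  simp [green]

theorem green_single_single (W : Matrix (Fin m) (Fin m) ℝ) (h : Fin m → ℝ) (i j : Fin m) :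
    green W h (Pi.single i 1) (Pi.single j 1) = (opMatrix W h)⁻¹ i j := by
  simp [green]

theorem opMatrix_mulVec_insertNth {W : Matrix (Fin (m + 1)) (Fin (m + 1)) ℝ} (hW : W.IsSymm)
    (p : Fin (m + 1)) (x t : ℝ) (h u : Fin m → ℝ) :
    opMatrix W (p.insertNth x h : Fin (m + 1) → ℝ) *ᵥ (p.insertNth t u : Fin (m + 1) → ℝ) =
      p.insertNth (x * t - row W p ⬝ᵥ u)
        (opMatrix (delWeight W p) h *ᵥ u - t • row W p) := by
  ext j
  refine Fin.succAboveCases p ?_ (fun j => ?_) j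
  · simp [Matrix.mulVec, dotProduct, Fin.sum_univ_succAbove _ p, opMatrix, row,
      (Fin.succAbove_ne p _).symm, sub_eq_add_neg]
  · simp [Matrix.mulVec, dotProduct, Fin.sum_univ_succAbove _ p, opMatrix, row, delWeight,
      hW.apply p]
    ring

theorem dotProduct_insertNth (p : Fin (m + 1)) (t : ℝ) (X : Fin (m + 1) → ℝ) (u : Fin m → ℝ) :
    X ⬝ᵥ (p.insertNth t u : Fin (m + 1) → ℝ) = X p * t + (X ∘ p.succAbove) ⬝ᵥ u := by
  simp [dotProduct, Fin.sum_univ_succAbove _ p]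

theorem mulVec_inv_mulVec {A : Matrix (Fin m) (Fin m) ℝ} (hA : A.PosDef) (Y : Fin m → ℝ) :
    A *ᵥ (A⁻¹ *ᵥ Y) = Y := by
  have : IsUnit A.det := (Matrix.isUnit_iff_isUnit_det _).1 hA.isUnit
  rw [Matrix.mulVec_mulVec, Matrix.mul_nonsing_inv _ this, Matrix.one_mulVec]

theorem inv_mulVec_eq {A : Matrix (Fin m) (Fin m) ℝ} (hA : A.PosDef) {v Y : Fin m → ℝ}
    (h : A *ᵥ v = Y) : A⁻¹ *ᵥ Y = v := by
  have : IsUnit A.det := (Matrix.isUnit_iff_isUnit_det _).1 hA.isUnit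
  rw [← h, Matrix.mulVec_mulVec, Matrix.nonsing_inv_mul _ this, Matrix.one_mulVec]

theorem dotProduct_opMatrix_mulVec_comm {W : Matrix (Fin m) (Fin m) ℝ} (hW : W.IsSymm)
    (h u v : Fin m → ℝ) : u ⬝ᵥ (opMatrix W h *ᵥ v) = v ⬝ᵥ (opMatrix W h *ᵥ u) := by
  rw [Matrix.dotProduct_mulVec, ← Matrix.mulVec_transpose, opMatrix_isSymm hW h, dotProduct_comm]

/-- Completing the square with respect to the vertex `p`. -/
theorem quadForm_schurDiag {W : Matrix (Fin (m + 1)) (Fin (m + 1)) ℝ} (hW : W.IsSymm)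
    (p : Fin (m + 1)) (x t : ℝ) (h u : Fin m → ℝ) (hpd : (opMatrix (delWeight W p) h).PosDef) :
    let w := u - t • ((opMatrix (delWeight W p) h)⁻¹ *ᵥ row W p)
    (p.insertNth t u : Fin (m + 1) → ℝ) ⬝ᵥ
        (opMatrix W (schurDiag W p x h) *ᵥ (p.insertNth t u : Fin (m + 1) → ℝ)) =
      x * t ^ 2 + w ⬝ᵥ (opMatrix (delWeight W p) h *ᵥ w) := by
  intro w
  set A := opMatrix (delWeight W p) h with hA
  set g := A⁻¹ *ᵥ row W p with hg
  have hAg : A *ᵥ g = row W p := mulVec_inv_mulVec hpd _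
  have hc : green (delWeight W p) h (row W p) (row W p) = row W p ⬝ᵥ g := rfl
  have h1 : g ⬝ᵥ (A *ᵥ u) = row W p ⬝ᵥ u := by
    rw [hA, dotProduct_opMatrix_mulVec_comm (delWeight_isSymm hW p), ← hA, hAg, dotProduct_comm]
  have hw : w = u - t • g := rfl
  rw [schurDiag, opMatrix_mulVec_insertNth hW, dotProduct_insertNth, hc, ← hA, hw]
  have h2 : (p.insertNth t u : Fin (m + 1) → ℝ) ∘ p.succAbove = u := by ext; simp
  rw [h2]
  simp only [Fin.insertNth_apply_same, Matrix.mulVec_sub, Matrix.mulVec_smul, hAg,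
    dotProduct_sub, sub_dotProduct, smul_dotProduct, dotProduct_smul, h1, smul_eq_mul,
    dotProduct_comm g (row W p), dotProduct_comm u (row W p)]
  ring

theorem posDef_schurDiag_iff {W : Matrix (Fin (m + 1)) (Fin (m + 1)) ℝ} (hW : W.IsSymm)
    (p : Fin (m + 1)) (x : ℝ) (h : Fin m → ℝ) :
    (opMatrix W (schurDiag W p x h)).PosDef ↔
      0 < x ∧ (opMatrix (delWeight W p) h).PosDef := by
  constructor
  · intro hH
    have hpd : (opMatrix (delWeight W p) h).PosDef := by
      have := hH.submatrix (Fin.succAbove_right_injective (p := p))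
      convert this using 1
      ext i j
      simp [opMatrix, delWeight, schurDiag]
    refine ⟨?_, hpd⟩
    set g := (opMatrix (delWeight W p) h)⁻¹ *ᵥ row W p with hg
    have hne : (p.insertNth 1 g : Fin (m + 1) → ℝ) ≠ 0 := fun h0 => by
      simpa using congrFun h0 p
    have := hH.dotProduct_mulVec_pos hne
    rw [star_trivial, quadForm_schurDiag hW p x 1 h g hpd] at this
    simpa [← hg] using this
  · rintro ⟨hx, hpd⟩
    refine Matrix.PosDef.of_dotProduct_mulVec_pos (opMatrix_isHermitian hW _) fun v hv => ?_
    obtain ⟨t, u, rfl⟩ : ∃ t u, v = (p.insertNth t u : Fin (m + 1) → ℝ) :=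
      ⟨v p, p.removeNth v, (Fin.insertNth_self_removeNth p v).symm⟩
    rw [star_trivial, quadForm_schurDiag hW p x t h u hpd]
    set w := u - t • ((opMatrix (delWeight W p) h)⁻¹ *ᵥ row W p) with hw
    have hw0 : 0 ≤ w ⬝ᵥ (opMatrix (delWeight W p) h *ᵥ w) := by
      simpa using hpd.posSemidef.dotProduct_mulVec_nonneg w
    by_cases ht : t = 0
    · have hu : w ≠ 0 := by
        rintro h0
        apply hv
        rw [hw, ht, zero_smul, sub_zero] at h0
        rw [ht, h0]
        ext j
        refine Fin.succAboveCases p ?_ (fun j => ?_) j <;> simp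
      have := hpd.dotProduct_mulVec_pos hu
      rw [star_trivial] at this
      simpa [ht] using this
    · have : 0 < x * t ^ 2 := by positivity
      linarith

theorem green_schurDiag {W : Matrix (Fin (m + 1)) (Fin (m + 1)) ℝ} (hW : W.IsSymm)
    (p : Fin (m + 1)) {x : ℝ} (hx : 0 < x) {h : Fin m → ℝ}
    (hpd : (opMatrix (delWeight W p) h).PosDef) (X Y : Fin (m + 1) → ℝ) :
    green W (schurDiag W p x h) X Y =
      green (delWeight W p) h (X ∘ p.succAbove) (Y ∘ p.succAbove) +
        (X p + green (delWeight W p) h (row W p) (X ∘ p.succAbove)) *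
          (Y p + green (delWeight W p) h (row W p) (Y ∘ p.succAbove)) / x := by
  have hH := (posDef_schurDiag_iff hW p x h).2 ⟨hx, hpd⟩
  rw [green_comm (delWeight_isSymm hW p) h (row W p) (X ∘ p.succAbove)]
  set A := opMatrix (delWeight W p) h with hA
  set y := A⁻¹ *ᵥ (Y ∘ p.succAbove) with hy
  set g := A⁻¹ *ᵥ row W p with hg
  have hc : ∀ Z, green (delWeight W p) h Z (row W p) = Z ⬝ᵥ g := fun _ => rfl
  have hz : ∀ Z, green (delWeight W p) h Z (Y ∘ p.succAbove) = Z ⬝ᵥ y := fun _ => rfl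
  set z := (Y p + row W p ⬝ᵥ y) / x with hzdef
  have hxz : x * z = Y p + row W p ⬝ᵥ y := by rw [hzdef]; field_simp
  have hinv : (opMatrix W (schurDiag W p x h))⁻¹ *ᵥ Y =
      (p.insertNth z (y + z • g) : Fin (m + 1) → ℝ) := by
    apply inv_mulVec_eq hH
    rw [schurDiag, opMatrix_mulVec_insertNth hW, ← hA, Matrix.mulVec_add, Matrix.mulVec_smul,
      hy, hg, mulVec_inv_mulVec hpd, mulVec_inv_mulVec hpd, ← hy, ← hg, hc]
    ext j
    refine Fin.succAboveCases p ?_ (fun j => ?_) j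
    · simp only [Fin.insertNth_apply_same, dotProduct_add, dotProduct_smul, smul_eq_mul]
      linarith
    · simp
  rw [green, hinv, dotProduct_insertNth, hc, hz, hz, dotProduct_add, dotProduct_smul, smul_eq_mul,
    hzdef]
  ring

theorem det_schurDiag {W : Matrix (Fin (m + 1)) (Fin (m + 1)) ℝ} (hW : W.IsSymm)
    (p : Fin (m + 1)) {x : ℝ} (hx : 0 < x) {h : Fin m → ℝ}
    (hpd : (opMatrix (delWeight W p) h).PosDef) :
    (opMatrix W (schurDiag W p x h)).det = x * (opMatrix (delWeight W p) h).det := by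
  have hH := (posDef_schurDiag_iff hW p x h).2 ⟨hx, hpd⟩
  have hdet := hH.det_pos
  have h1 := green_schurDiag hW p hx hpd (Pi.single p 1) (Pi.single p 1)
  -- The diagonal entry of the inverse is the ratio of the two determinants.
  rw [green_single_single, single_comp_succAbove, Matrix.inv_def, Matrix.smul_apply,
    Matrix.adjugate_fin_succ_eq_det_submatrix] at h1
  have h3 : (opMatrix W (schurDiag W p x h)).submatrix p.succAbove p.succAbove =
      opMatrix (delWeight W p) h := by
    ext i j
    simp [opMatrix, delWeight, schurDiag]
  simp [h3, green, ← two_mul] at h1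
  field_simp at h1
  linarith

/-- The inverse of a positive definite matrix with nonpositive off-diagonal entries has
nonnegative entries. -/
theorem green_nonneg : ∀ {m : ℕ} {W : Matrix (Fin m) (Fin m) ℝ}, W.IsSymm →
    (∀ i j, i ≠ j → 0 ≤ W i j) → ∀ {h : Fin m → ℝ}, (opMatrix W h).PosDef →
    ∀ {X Y : Fin m → ℝ}, (∀ j, 0 ≤ X j) → (∀ j, 0 ≤ Y j) → 0 ≤ green W h X Y
  | 0, _, _, _, _, _, _, _, _, _ => by simp [green]
  | m + 1, W, hW, hnn, h, hpd, X, Y, hX, hY => by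
    obtain ⟨x, h', rfl⟩ : ∃ x h', h = schurDiag W 0 x h' :=
      ⟨h 0 - green (delWeight W 0) (Fin.removeNth 0 h) (row W 0) (row W 0), Fin.removeNth 0 h, by
        rw [schurDiag, sub_add_cancel]
        exact (Fin.insertNth_self_removeNth 0 h).symm⟩
    obtain ⟨hx, hpd'⟩ := (posDef_schurDiag_iff hW 0 x h').1 hpd
    have ih : ∀ {X Y : Fin m → ℝ}, (∀ j, 0 ≤ X j) → (∀ j, 0 ≤ Y j) →
        0 ≤ green (delWeight W 0) h' X Y :=
      green_nonneg (delWeight_isSymm hW 0)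
        (fun i j hij => hnn _ _ fun h => hij (Fin.succAbove_right_injective h)) hpd'
    have hrow : ∀ j, 0 ≤ row W 0 j := fun j => hnn _ _ (Fin.succAbove_ne _ _).symm
    rw [green_schurDiag hW 0 hx hpd']
    have h1 := ih (fun j => hX (Fin.succAbove 0 j)) (fun j => hY (Fin.succAbove 0 j))
    have h2 := ih hrow (fun j => hX (Fin.succAbove 0 j))
    have h3 := ih hrow (fun j => hY (Fin.succAbove 0 j))
    have h4 := mul_nonneg (add_nonneg (hX 0) h2) (add_nonneg (hY 0) h3)
    exact add_nonneg h1 (div_nonneg h4 hx.le)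

/-- Every vertex is joined to the root by edges of positive weight, where `η j` is the weight of the
edge from `j` to the root: each nonempty set of vertices has an edge leading out of it, either to
its complement or to the root. -/
def Rooted (W : Matrix (Fin m) (Fin m) ℝ) (η : Fin m → ℝ) : Prop :=
  ∀ A : Set (Fin m), A.Nonempty → ∃ j ∈ A, 0 < η j ∨ ∃ k ∉ A, 0 < W j k

theorem Rooted.mono {W W' : Matrix (Fin m) (Fin m) ℝ} {η η' : Fin m → ℝ} (hr : Rooted W η)
    (hW : ∀ i j, W i j ≤ W' i j) (hη : ∀ j, η j ≤ η' j) : Rooted W' η' := fun A hA => by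
  obtain ⟨j, hj, h⟩ := hr A hA
  exact ⟨j, hj, h.imp (fun h => h.trans_le (hη j)) fun ⟨k, hk, h⟩ => ⟨k, hk, h.trans_le (hW j k)⟩⟩

/-- The field `H⁻¹ η` is positive at every vertex: the set on which it vanishes would have no edge
leading out of it. -/
theorem green_single_pos {W : Matrix (Fin m) (Fin m) ℝ} (hW : W.IsSymm)
    (hnn : ∀ i j, i ≠ j → 0 ≤ W i j) {η : Fin m → ℝ} (hη : ∀ j, 0 ≤ η j) (hr : Rooted W η)
    {h : Fin m → ℝ} (hpd : (opMatrix W h).PosDef) (j : Fin m) :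
    0 < green W h (Pi.single j 1) η := by
  set v := (opMatrix W h)⁻¹ *ᵥ η with hv
  have hv0 : ∀ j, 0 ≤ v j := fun j => by
    rw [hv, ← green_single_left]
    exact green_nonneg hW hnn hpd (fun k => by by_cases h : k = j <;> simp [h]) hη
  have hHv : opMatrix W h *ᵥ v = η := mulVec_inv_mulVec hpd η
  rw [green_single_left, ← hv]
  by_contra hj
  obtain ⟨a, ha, hcut⟩ := hr {k | v k = 0} ⟨j, le_antisymm (not_lt.1 hj) (hv0 j)⟩
  have ha' : v a = 0 := ha
  have hterm : ∀ k, opMatrix W h a k * v k ≤ 0 := fun k => by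
    by_cases hk : a = k
    · simp [← hk, ha']
    · simp only [opMatrix, Matrix.of_apply, hk, if_false]
      nlinarith [hnn a k hk, hv0 k]
  have hsum : ∑ k, opMatrix W h a k * v k = η a := congrFun hHv a
  rcases hcut with h1 | ⟨k, hk, hWk⟩
  · have := Finset.sum_nonpos fun k (_ : k ∈ Finset.univ) => hterm k
    linarith
  · have hk' : v k ≠ 0 := hk
    have hvk : 0 < v k := lt_of_le_of_ne (hv0 k) (Ne.symm hk')
    have hak : a ≠ k := fun h => hk' (h ▸ ha')
    have : ∑ k, opMatrix W h a k * v k < 0 := by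
      refine Finset.sum_neg' (fun k _ => hterm k) ⟨k, Finset.mem_univ _, ?_⟩
      simp only [opMatrix, Matrix.of_apply, hak, if_false]
      nlinarith
    linarith [hη a]

/-! ### The inverse Gaussian family -/

/-- The density on `(0, ∞)` of the inverse Gaussian law with mean `1` and shape `κ`, multiplied by
`√(2π)`. -/
def ig (κ r : ℝ) : ℝ :=
  Real.sqrt κ / (r * Real.sqrt r) * Real.exp (-(κ / 2) * (r + 1 / r - 2))

/-- Integration over `(0, ∞)` against the unnormalised inverse Gaussian density. -/
def igLintegral (κ : ℝ) (g : ℝ → ℝ≥0∞) : ℝ≥0∞ :=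
  ∫⁻ r in Set.Ioi (0 : ℝ), g r * ENNReal.ofReal (ig κ r)

@[fun_prop]
theorem measurable_ig : Measurable (fun z : ℝ × ℝ => ig z.1 z.2) := by
  unfold ig
  fun_prop

theorem ig_nonneg {κ r : ℝ} (hr : 0 < r) : 0 ≤ ig κ r := by
  unfold ig; positivity

theorem lintegral_gaussian :
    ∫⁻ u : ℝ, ENNReal.ofReal (2 * Real.exp (-u ^ 2 / 2)) =
      ENNReal.ofReal (2 * Real.sqrt (2 * Real.pi)) := by
  have h := integral_gaussian (1 / 2)
  have hi := integrable_exp_neg_mul_sq (b := 1 / 2) (by norm_num)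
  rw [← ofReal_integral_eq_lintegral_ofReal]
  · rw [integral_const_mul]
    congr 2
    rw [show (2 * Real.pi) = Real.pi / (1 / 2) by ring, ← h]
    congr 1; ext u; congr 1; ring
  · convert hi.const_mul 2 using 4
    ring
  · exact Filter.Eventually.of_forall fun u => by positivity

/-- The substitution `u = √κ (√r - 1/√r)` turns the sum of the masses of `ig κ r` and `r * ig κ r`
into a Gaussian integral. -/
theorem lintegral_ig_add {κ : ℝ} (hκ : 0 < κ) :
    ∫⁻ r in Set.Ioi (0 : ℝ), ENNReal.ofReal (ig κ r + r * ig κ r) =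
      ENNReal.ofReal (2 * Real.sqrt (2 * Real.pi)) := by
  set s := Real.sqrt κ with hs
  have hs0 : 0 < s := Real.sqrt_pos.2 hκ
  have hss : s ^ 2 = κ := Real.sq_sqrt hκ.le
  let f : ℝ → ℝ := fun r => s * (Real.sqrt r - (Real.sqrt r)⁻¹)
  let f' : ℝ → ℝ := fun r =>
    s * (1 / (2 * Real.sqrt r) - -(1 / (2 * Real.sqrt r)) / Real.sqrt r ^ 2)
  have hf' : ∀ r ∈ Set.Ioi (0 : ℝ), HasDerivWithinAt f (f' r) (Set.Ioi 0) r := by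
    intro r hr
    have hr' : (0 : ℝ) < r := hr
    have h1 := Real.hasDerivAt_sqrt hr'.ne'
    exact ((h1.sub (h1.inv (Real.sqrt_pos.2 hr').ne')).const_mul s).hasDerivWithinAt
  have hinj : Set.InjOn f (Set.Ioi 0) := by
    intro a ha b hb hab
    have ha' : 0 < Real.sqrt a := Real.sqrt_pos.2 ha
    have hb' : 0 < Real.sqrt b := Real.sqrt_pos.2 hb
    have h2 : Real.sqrt a - (Real.sqrt a)⁻¹ = Real.sqrt b - (Real.sqrt b)⁻¹ :=
      mul_left_cancel₀ hs0.ne' hab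
    have h3 : (Real.sqrt a - Real.sqrt b) * (1 + 1 / (Real.sqrt a * Real.sqrt b)) = 0 := by
      field_simp at h2 ⊢
      linarith
    have h4 : Real.sqrt a = Real.sqrt b := by
      rcases mul_eq_zero.1 h3 with h | h
      · linarith
      · have : 0 < 1 / (Real.sqrt a * Real.sqrt b) := by positivity
        linarith
    exact (Real.sqrt_inj (le_of_lt ha) (le_of_lt hb)).1 h4
  have himg : f '' Set.Ioi 0 = Set.univ := by
    refine Set.eq_univ_of_forall fun u => ?_
    set c := u / s with hc
    set t := (c + Real.sqrt (c ^ 2 + 4)) / 2 with ht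
    have hsq : Real.sqrt (c ^ 2 + 4) ^ 2 = c ^ 2 + 4 := Real.sq_sqrt (by positivity)
    have ht0 : 0 < t := by
      have : |c| < Real.sqrt (c ^ 2 + 4) := Real.lt_sqrt_of_sq_lt (by rw [sq_abs]; linarith)
      have := neg_abs_le c
      linarith
    refine ⟨t ^ 2, by simpa using pow_pos ht0 2, ?_⟩
    have h5 : t ^ 2 - 1 = c * t := by rw [ht]; nlinarith
    simp only [f, Real.sqrt_sq ht0.le]
    have h6 : t - t⁻¹ = c := by field_simp; linarith
    rw [h6, hc]; field_simp
  have key := lintegral_image_eq_lintegral_abs_deriv_mul measurableSet_Ioi hf' hinj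
    (fun u => ENNReal.ofReal (2 * Real.exp (-u ^ 2 / 2)))
  rw [himg, Measure.restrict_univ, lintegral_gaussian] at key
  rw [key]
  refine setLIntegral_congr_fun measurableSet_Ioi fun r hr => ?_
  have hr' : (0 : ℝ) < r := hr
  set t := Real.sqrt r with ht
  have ht0 : 0 < t := Real.sqrt_pos.2 hr'
  have htt : r = t ^ 2 := (Real.sq_sqrt hr'.le).symm
  have hpos : 0 < f' r := by
    simp only [f']
    rw [neg_div, sub_neg_eq_add]
    positivity
  rw [abs_of_pos hpos, ← ENNReal.ofReal_mul hpos.le]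
  congr 1
  have hexp : -(κ / 2) * (r + 1 / r - 2) = -(f r) ^ 2 / 2 := by
    simp only [f]
    rw [← ht, ← hss, htt]
    field_simp
    ring
  rw [ig, hexp, ← hs, ← ht, htt]
  simp only [f']
  rw [← htt, ← ht]
  rw [htt]
  field_simp
  ring

/-- The inverse Gaussian law of mean `1`, size-biased, is its image under `r ↦ 1/r`. -/
theorem lintegral_ig_eq_lintegral_mul_ig (κ : ℝ) :
    ∫⁻ r in Set.Ioi (0 : ℝ), ENNReal.ofReal (ig κ r) =
      ∫⁻ r in Set.Ioi (0 : ℝ), ENNReal.ofReal (r * ig κ r) := by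
  have hf' : ∀ r ∈ Set.Ioi (0 : ℝ),
      HasDerivWithinAt (fun r : ℝ => r⁻¹) (-(r ^ 2)⁻¹) (Set.Ioi 0) r :=
    fun r hr => (hasDerivAt_inv (ne_of_gt hr)).hasDerivWithinAt
  have himg : (fun r : ℝ => r⁻¹) '' Set.Ioi 0 = Set.Ioi 0 := by
    ext r
    constructor
    · rintro ⟨a, ha, rfl⟩
      exact inv_pos.2 (Set.mem_Ioi.1 ha)
    · intro hr
      exact ⟨r⁻¹, inv_pos.2 (Set.mem_Ioi.1 hr), inv_inv r⟩
  have key := lintegral_image_eq_lintegral_abs_deriv_mul measurableSet_Ioi hf'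
    inv_injective.injOn (fun r => ENNReal.ofReal (ig κ r))
  rw [himg] at key
  rw [key]
  refine setLIntegral_congr_fun measurableSet_Ioi fun r hr => ?_
  have hr' : (0 : ℝ) < r := hr
  rw [← ENNReal.ofReal_mul (abs_nonneg _)]
  congr 1
  have h1 : |(-(r ^ 2)⁻¹)| = (r ^ 2)⁻¹ := by rw [abs_neg, abs_of_pos (by positivity)]
  have h2 : r⁻¹ + 1 / r⁻¹ - 2 = r + 1 / r - 2 := by field_simp; ring
  rw [h1, ig, ig, h2, Real.sqrt_inv]
  set t := Real.sqrt r with ht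
  have ht0 : 0 < t := Real.sqrt_pos.2 hr'
  have htt : r = t ^ 2 := (Real.sq_sqrt hr'.le).symm
  generalize Real.exp (-(κ / 2) * (r + 1 / r - 2)) = e
  rw [htt]
  field_simp

theorem lintegral_ig {κ : ℝ} (hκ : 0 < κ) :
    ∫⁻ r in Set.Ioi (0 : ℝ), ENNReal.ofReal (ig κ r) =
      ENNReal.ofReal (Real.sqrt (2 * Real.pi)) := by
  have h := lintegral_ig_add hκ
  have h1 : ∫⁻ r in Set.Ioi (0 : ℝ), ENNReal.ofReal (ig κ r + r * ig κ r) =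
      (∫⁻ r in Set.Ioi (0 : ℝ), ENNReal.ofReal (ig κ r)) +
        ∫⁻ r in Set.Ioi (0 : ℝ), ENNReal.ofReal (r * ig κ r) := by
    rw [← lintegral_add_left (by fun_prop)]
    refine setLIntegral_congr_fun measurableSet_Ioi fun r hr => ?_
    have hr' : (0 : ℝ) < r := hr
    exact ENNReal.ofReal_add (ig_nonneg hr') (mul_nonneg hr'.le (ig_nonneg hr'))
  rw [h1, ← lintegral_ig_eq_lintegral_mul_ig, ← two_mul, ENNReal.ofReal_mul (by norm_num),
    ENNReal.ofReal_ofNat] at h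
  exact (ENNReal.mul_right_inj (by norm_num) (by norm_num)).1 h

theorem lintegral_mul_ig {κ : ℝ} (hκ : 0 < κ) :
    ∫⁻ r in Set.Ioi (0 : ℝ), ENNReal.ofReal (r * ig κ r) =
      ENNReal.ofReal (Real.sqrt (2 * Real.pi)) := by
  rw [← lintegral_ig_eq_lintegral_mul_ig, lintegral_ig hκ]

theorem igLintegral_affine {κ : ℝ} (hκ : 0 < κ) {A B : ℝ} (hA : 0 ≤ A) (hB : 0 ≤ B) :
    igLintegral κ (fun r => ENNReal.ofReal (A + B * r)) =
      ENNReal.ofReal (A + B) * ENNReal.ofReal (Real.sqrt (2 * Real.pi)) := by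
  have h1 : igLintegral κ (fun r => ENNReal.ofReal (A + B * r)) =
      ∫⁻ r in Set.Ioi (0 : ℝ), (ENNReal.ofReal A * ENNReal.ofReal (ig κ r) +
        ENNReal.ofReal B * ENNReal.ofReal (r * ig κ r)) := by
    refine setLIntegral_congr_fun measurableSet_Ioi fun r hr => ?_
    have hr' : (0 : ℝ) < r := hr
    beta_reduce
    rw [← ENNReal.ofReal_mul (by positivity), ← ENNReal.ofReal_mul hA, ← ENNReal.ofReal_mul hB,
      ← ENNReal.ofReal_add (mul_nonneg hA (ig_nonneg hr'))
        (mul_nonneg hB (mul_nonneg hr'.le (ig_nonneg hr')))]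
    congr 1; ring
  rw [h1, lintegral_add_left (by fun_prop), lintegral_const_mul _ (by fun_prop),
    lintegral_const_mul _ (by fun_prop), lintegral_ig hκ, lintegral_mul_ig hκ,
    ENNReal.ofReal_add hA hB, add_mul]

/-- A convex function lies below its chord between the endpoints and above it elsewhere. -/
theorem sub_chord_mul_nonneg {g : ℝ → ℝ} {s : Set ℝ} (hg : ConvexOn ℝ s g) {a b r : ℝ} (ha : a ∈ s)
    (hb : b ∈ s) (hr : r ∈ s) (hab : a < b) :
    0 ≤ (g r - (g a + (g b - g a) / (b - a) * (r - a))) * ((r - a) * (r - b)) := by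
  have hba : 0 < b - a := sub_pos.2 hab
  have e : (g r - (g a + (g b - g a) / (b - a) * (r - a))) * ((r - a) * (r - b)) =
      ((g r - g a) * (b - a) - (g b - g a) * (r - a)) * ((r - a) * (r - b)) / (b - a) := by
    field_simp
    ring
  rw [e]
  refine div_nonneg ?_ hba.le
  rcases lt_trichotomy r a with h | h | h
  · have := hg.slope_mono_adjacent hr hb h hab
    rw [div_le_div_iff₀ (by linarith) hba] at this
    exact mul_nonneg (by nlinarith) (mul_nonneg_of_nonpos_of_nonpos (by linarith) (by linarith))
  · simp [h]
  · rcases lt_trichotomy r b with h' | h' | h'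
    · have := hg.slope_mono_adjacent ha hb h h'
      rw [div_le_div_iff₀ (by linarith) (by linarith)] at this
      exact mul_nonneg_of_nonpos_of_nonpos (by nlinarith)
        (mul_nonpos_of_nonneg_of_nonpos (by linarith) (by linarith))
    · simp [h']
    · have := hg.slope_mono_adjacent ha hr hab h'
      rw [div_le_div_iff₀ hba (by linarith)] at this
      exact mul_nonneg (by nlinarith) (mul_nonneg (by linarith) (by linarith))

/-- Two inverse Gaussian densities of mean `1` cross exactly at two points `a < 1/a`; the one with
the larger shape parameter is the larger one between them. -/
theorem exists_ig_crossing {κ₁ κ₂ : ℝ} (h₁ : 0 < κ₁) (h₁₂ : κ₁ < κ₂) :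
    ∃ a b : ℝ, 0 < a ∧ a < b ∧ ∀ r, 0 < r →
      ((r - a) * (r - b) ≤ 0 → ig κ₁ r ≤ ig κ₂ r) ∧
      (0 ≤ (r - a) * (r - b) → ig κ₂ r ≤ ig κ₁ r) := by
  have h₂ : 0 < κ₂ := h₁.trans h₁₂
  have hd : 0 < κ₂ - κ₁ := sub_pos.2 h₁₂
  set L := (Real.log κ₂ - Real.log κ₁) / (κ₂ - κ₁) with hL
  have hL0 : 0 < L := div_pos (sub_pos.2 (Real.log_lt_log h₁ h₁₂)) hd
  have hLe : L * (κ₂ - κ₁) = Real.log κ₂ - Real.log κ₁ := by rw [hL]; field_simp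
  set D := Real.sqrt ((L + 2) ^ 2 - 4) with hD
  have hDsq : D ^ 2 = (L + 2) ^ 2 - 4 := Real.sq_sqrt (by nlinarith)
  have hD0 : 0 < D := Real.sqrt_pos.2 (by nlinarith)
  have hDL : D < L + 2 := by nlinarith
  refine ⟨(L + 2 - D) / 2, (L + 2 + D) / 2, by linarith, by linarith, fun r hr => ?_⟩
  have hfac : (r - (L + 2 - D) / 2) * (r - (L + 2 + D) / 2) = r * (r + 1 / r - 2 - L) := by
    field_simp
    nlinarith
  have hig : ∀ κ, 0 < κ → ig κ r = (r * Real.sqrt r)⁻¹ *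
      Real.exp (1 / 2 * (Real.log κ - κ * (r + 1 / r - 2))) := fun κ hκ => by
    have : Real.sqrt κ = Real.exp (1 / 2 * Real.log κ) := by
      rw [Real.sqrt_eq_rpow, Real.rpow_def_of_pos hκ, mul_comm]
    rw [ig, this, div_eq_inv_mul, mul_assoc, ← Real.exp_add]
    congr 2; ring
  rw [hfac, hig _ h₁, hig _ h₂]
  constructor
  · intro h
    have hq : r + 1 / r - 2 - L ≤ 0 := by
      by_contra hc
      exact absurd h (not_le.2 (mul_pos hr (not_le.1 hc)))
    gcongr ?_ * Real.exp (1 / 2 * ?_)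
    nlinarith
  · intro h
    have hq : 0 ≤ r + 1 / r - 2 - L := by
      by_contra hc
      exact absurd h (not_le.2 (mul_neg_of_pos_of_neg hr (not_le.1 hc)))
    gcongr ?_ * Real.exp (1 / 2 * ?_)
    nlinarith

/-- The inverse Gaussian laws of mean `1` decrease in the convex order as the shape increases: the
difference of two densities has the sign pattern `-, +, -`, and it integrates affine functions to
zero, so that a convex function may be replaced by its difference with the chord through the two
crossing points. -/
theorem igLintegral_anti {g : ℝ → ℝ} (hg : ConvexOn ℝ (Set.Ioi 0) g) (hg0 : ∀ r, 0 < r → 0 ≤ g r)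
    {κ₁ κ₂ : ℝ} (h₁ : 0 < κ₁) (h₁₂ : κ₁ ≤ κ₂) :
    igLintegral κ₂ (fun r => ENNReal.ofReal (g r)) ≤
      igLintegral κ₁ (fun r => ENNReal.ofReal (g r)) := by
  rcases h₁₂.eq_or_lt with rfl | hlt
  · exact le_rfl
  obtain ⟨a, b, ha, hab, hcross⟩ := exists_ig_crossing h₁ hlt
  set B := (g b - g a) / (b - a) with hB
  set A := g a - B * a with hA
  -- `M * (1 + r)` is added to the chord to make it nonnegative.
  set M := |A| + |B| with hM
  have hMA : 0 ≤ A + M := by have := neg_abs_le A; have := abs_nonneg B; linarith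
  have hMB : 0 ≤ B + M := by have := neg_abs_le B; have := abs_nonneg A; linarith
  have hM0 : 0 ≤ M := by positivity
  have h₂ : 0 < κ₂ := h₁.trans hlt
  let ℓ : ℝ → ℝ≥0∞ := fun r => ENNReal.ofReal (A + M + (B + M) * r)
  let k : ℝ → ℝ≥0∞ := fun r => ENNReal.ofReal (M + M * r)
  have hℓ := fun κ hκ => igLintegral_affine (κ := κ) hκ hMA hMB
  have hk := fun κ hκ => igLintegral_affine (κ := κ) hκ hM0 hM0
  have hmeas : ∀ κ, ∀ c d : ℝ, Measurable fun r : ℝ =>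
      ENNReal.ofReal (c + d * r) * ENNReal.ofReal (ig κ r) := fun κ c d => by fun_prop
  have main : igLintegral κ₂ (fun r => ENNReal.ofReal (g r)) + igLintegral κ₁ ℓ + igLintegral κ₂ k ≤
      igLintegral κ₁ (fun r => ENNReal.ofReal (g r)) + igLintegral κ₂ ℓ + igLintegral κ₁ k := by
    simp only [igLintegral, ℓ, k]
    rw [← lintegral_add_right _ (hmeas _ _ _), ← lintegral_add_right _ (hmeas _ _ _),
      ← lintegral_add_right _ (hmeas _ _ _), ← lintegral_add_right _ (hmeas _ _ _)]
    refine setLIntegral_mono' measurableSet_Ioi fun r hr => ?_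
    have hr' : (0 : ℝ) < r := hr
    have e1 : 0 ≤ A + M + (B + M) * r := by positivity
    have e2 : 0 ≤ M + M * r := by positivity
    have i1 := ig_nonneg (κ := κ₁) hr'
    have i2 := ig_nonneg (κ := κ₂) hr'
    have hg' := hg0 r hr'
    rw [← ENNReal.ofReal_mul hg', ← ENNReal.ofReal_mul hg', ← ENNReal.ofReal_mul e1,
      ← ENNReal.ofReal_mul e1, ← ENNReal.ofReal_mul e2, ← ENNReal.ofReal_mul e2,
      ← ENNReal.ofReal_add (by positivity) (by positivity),
      ← ENNReal.ofReal_add (by positivity) (by positivity),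
      ← ENNReal.ofReal_add (by positivity) (by positivity),
      ← ENNReal.ofReal_add (by positivity) (by positivity)]
    refine ENNReal.ofReal_le_ofReal ?_
    have hs := sub_chord_mul_nonneg hg (Set.mem_Ioi.2 ha) (Set.mem_Ioi.2 (ha.trans hab)) hr hab
    rw [← hB] at hs
    have hch : g a + B * (r - a) = A + B * r := by rw [hA]; ring
    rw [hch] at hs
    obtain ⟨c1, c2⟩ := hcross r hr'
    have hsign : (g r - (A + B * r)) * (ig κ₂ r - ig κ₁ r) ≤ 0 := by
      rcases lt_trichotomy ((r - a) * (r - b)) 0 with h | h | h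
      · exact mul_nonpos_of_nonpos_of_nonneg
          (by by_contra hc; exact absurd hs (not_le.2 (mul_neg_of_pos_of_neg (not_le.1 hc) h)))
          (sub_nonneg.2 (c1 h.le))
      · rw [le_antisymm (c2 h.ge) (c1 h.le)]; simp
      · exact mul_nonpos_of_nonneg_of_nonpos (nonneg_of_mul_nonneg_left hs h)
          (sub_nonpos.2 (c2 h.le))
    nlinarith
  simp only [ℓ, k] at main
  rw [hℓ _ h₁, hℓ _ h₂, hk _ h₁, hk _ h₂, add_assoc (igLintegral _ _),
    add_assoc (igLintegral _ _)] at main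
  refine (ENNReal.add_le_add_iff_right ?_).1 main
  finiteness

/-! ### Changes of variables in one and two dimensions -/

theorem image_div_Ioi {y : ℝ} (hy : 0 < y) (c : ℝ) :
    (fun s : ℝ => y / (s - c)) '' Set.Ioi c = Set.Ioi 0 := by
  ext r
  constructor
  · rintro ⟨a, ha, rfl⟩
    exact div_pos hy (sub_pos.2 ha)
  · intro hr
    have hr' : (0 : ℝ) < r := hr
    refine ⟨c + y / r, by simpa using div_pos hy hr', ?_⟩
    simp only [add_sub_cancel_left]
    field_simp

/-- The substitution `t = y / (s - c)`. -/
theorem lintegral_comp_div_sub {y : ℝ} (hy : 0 < y) (c : ℝ) (F : ℝ → ℝ≥0∞) :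
    ∫⁻ t in Set.Ioi (0 : ℝ), F t =
      ∫⁻ s in Set.Ioi c, ENNReal.ofReal (y / (s - c) ^ 2) * F (y / (s - c)) := by
  have hf' : ∀ s ∈ Set.Ioi c, HasDerivWithinAt (fun s : ℝ => y / (s - c)) (-(y / (s - c) ^ 2))
      (Set.Ioi c) s := fun s hs => by
    have hs' : s - c ≠ 0 := (sub_pos.2 hs).ne'
    have h := (((hasDerivAt_id s).sub_const c).inv hs').const_mul y
    have e : y * (-1 / (id s - c) ^ 2) = -(y / (s - c) ^ 2) := by simp only [id]; ring
    exact (e ▸ h).hasDerivWithinAt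
  have hinj : Set.InjOn (fun s : ℝ => y / (s - c)) (Set.Ioi c) := by
    intro a ha b hb hab
    have ha' : 0 < a - c := sub_pos.2 ha
    have hb' : 0 < b - c := sub_pos.2 hb
    simp only at hab
    rw [div_eq_div_iff ha'.ne' hb'.ne'] at hab
    have := mul_left_cancel₀ hy.ne' hab
    linarith
  have key := lintegral_image_eq_lintegral_abs_deriv_mul measurableSet_Ioi hf' hinj F
  rw [image_div_Ioi hy] at key
  rw [key]
  refine setLIntegral_congr_fun measurableSet_Ioi fun s hs => ?_
  have hs' : 0 < s - c := sub_pos.2 hs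
  rw [abs_neg, abs_of_pos (by positivity)]

/-- The substitution `x = c + k r`. -/
theorem lintegral_comp_add_mul {k : ℝ} (hk : 0 < k) (c : ℝ) (F : ℝ → ℝ≥0∞) :
    ∫⁻ x in Set.Ioi c, F x = ∫⁻ r in Set.Ioi (0 : ℝ), ENNReal.ofReal k * F (c + k * r) := by
  have hf' : ∀ r ∈ Set.Ioi (0 : ℝ), HasDerivWithinAt (fun r : ℝ => c + k * r) k
      (Set.Ioi 0) r := fun r _ => by
    have h := ((hasDerivAt_id r).const_mul k).const_add c
    simpa using h.hasDerivWithinAt (s := Set.Ioi 0)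
  have hinj : Set.InjOn (fun r : ℝ => c + k * r) (Set.Ioi 0) := by
    intro a _ b _ hab
    exact mul_left_cancel₀ hk.ne' (add_left_cancel hab)
  have himg : (fun r : ℝ => c + k * r) '' Set.Ioi 0 = Set.Ioi c := by
    ext x
    constructor
    · rintro ⟨a, ha, rfl⟩
      have : 0 < k * a := mul_pos hk ha
      simpa using this
    · intro hx
      refine ⟨(x - c) / k, div_pos (sub_pos.2 hx) hk, ?_⟩
      simp only
      field_simp
      ring
  have key := lintegral_image_eq_lintegral_abs_deriv_mul measurableSet_Ioi hf' hinj F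
  rw [himg] at key
  rw [key, abs_of_pos hk]

/-- The law of the Schur complement at a vertex where the boundary term is `y`: the value of the
field there is `y` over the Schur complement, which is inverse Gaussian with shape `y`. -/
theorem lintegral_eq_igLintegral {y : ℝ} (hy : 0 < y) (Φ : ℝ → ℝ≥0∞) :
    ∫⁻ x in Set.Ioi (0 : ℝ),
        Φ (y / x) * ENNReal.ofReal (Real.exp (-(x + y ^ 2 / x) / 2) / Real.sqrt x) =
      ENNReal.ofReal (Real.exp (-y)) * igLintegral y Φ := by
  rw [lintegral_comp_div_sub hy 0, igLintegral, ← lintegral_const_mul' _ _ ENNReal.ofReal_ne_top]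
  refine setLIntegral_congr_fun measurableSet_Ioi fun r hr => ?_
  have hr' : (0 : ℝ) < r := hr
  simp only [sub_zero]
  rw [div_div_cancel₀ hy.ne', mul_left_comm, mul_left_comm _ (Φ r),
    ← ENNReal.ofReal_mul (by positivity), ← ENNReal.ofReal_mul (by positivity)]
  congr 2
  have hE : Real.exp (-(y / r + y ^ 2 / (y / r)) / 2) =
      Real.exp (-y) * Real.exp (-(y / 2) * (r + 1 / r - 2)) := by
    rw [← Real.exp_add]
    congr 1
    field_simp
    ring
  rw [hE, ig, Real.sqrt_div hy.le]
  generalize Real.exp (-(y / 2) * (r + 1 / r - 2)) = e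
  have hsy : y = Real.sqrt y ^ 2 := (Real.sq_sqrt hy.le).symm
  have hsr : r = Real.sqrt r ^ 2 := (Real.sq_sqrt hr'.le).symm
  have hsy0 : 0 < Real.sqrt y := Real.sqrt_pos.2 hy
  have hsr0 : 0 < Real.sqrt r := Real.sqrt_pos.2 hr'
  generalize Real.exp (-y) = e'
  set t := Real.sqrt y
  set u := Real.sqrt r
  rw [hsy, hsr]
  field_simp

/-- Exchange of the order of integration over the region `{x, s > 0, x s > c}`. -/
theorem lintegral_hyperbola_swap {c : ℝ} (hc : 0 ≤ c) {G : ℝ → ℝ → ℝ≥0∞}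
    (hG : Measurable fun z : ℝ × ℝ => G z.1 z.2) :
    ∫⁻ x in Set.Ioi (0 : ℝ), ∫⁻ s in Set.Ioi (c / x), G x s =
      ∫⁻ s in Set.Ioi (0 : ℝ), ∫⁻ x in Set.Ioi (c / s), G x s := by
  let R : Set (ℝ × ℝ) := {z | 0 < z.1 ∧ 0 < z.2 ∧ c < z.1 * z.2}
  have hR : MeasurableSet R := by
    have : IsOpen R := by
      refine (isOpen_lt continuous_const continuous_fst).inter
        ((isOpen_lt continuous_const continuous_snd).inter
          (isOpen_lt continuous_const (continuous_fst.mul continuous_snd)))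
    exact this.measurableSet
  have key : ∀ x s : ℝ, (Set.Ioi (0 : ℝ)).indicator
      (fun x => (Set.Ioi (c / x)).indicator (fun s => G x s) s) x =
        R.indicator (fun z => G z.1 z.2) (x, s) := by
    intro x s
    by_cases hx : 0 < x
    · by_cases hs : c / x < s
      · have h1 : c < x * s := by rw [div_lt_iff₀ hx] at hs; linarith
        have h2 : 0 < s := lt_of_le_of_lt (div_nonneg hc hx.le) hs
        rw [Set.indicator_of_mem (Set.mem_Ioi.2 hx), Set.indicator_of_mem (Set.mem_Ioi.2 hs),
          Set.indicator_of_mem (show (x, s) ∈ R from ⟨hx, h2, h1⟩)]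
      · have h1 : (x, s) ∉ R := by
          rintro ⟨_, _, h⟩
          apply hs
          rw [div_lt_iff₀ hx]
          simp only at h
          linarith
        rw [Set.indicator_of_mem (Set.mem_Ioi.2 hx), Set.indicator_of_notMem (by simpa using hs),
          Set.indicator_of_notMem h1]
    · have h1 : (x, s) ∉ R := fun h => hx h.1
      rw [Set.indicator_of_notMem (by simpa using hx), Set.indicator_of_notMem h1]
  have key' : ∀ x s : ℝ, (Set.Ioi (0 : ℝ)).indicator
      (fun s => (Set.Ioi (c / s)).indicator (fun x => G x s) x) s =
        R.indicator (fun z => G z.1 z.2) (x, s) := by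
    intro x s
    by_cases hx : 0 < s
    · by_cases hs : c / s < x
      · have h1 : c < x * s := by rwa [div_lt_iff₀ hx] at hs
        have h2 : 0 < x := lt_of_le_of_lt (div_nonneg hc hx.le) hs
        rw [Set.indicator_of_mem (Set.mem_Ioi.2 hx), Set.indicator_of_mem (Set.mem_Ioi.2 hs),
          Set.indicator_of_mem (show (x, s) ∈ R from ⟨h2, hx, h1⟩)]
      · have h1 : (x, s) ∉ R := by
          rintro ⟨_, _, h⟩
          apply hs
          rwa [div_lt_iff₀ hx]
        rw [Set.indicator_of_mem (Set.mem_Ioi.2 hx), Set.indicator_of_notMem (by simpa using hs),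
          Set.indicator_of_notMem h1]
    · have h1 : (x, s) ∉ R := fun h => hx h.2.1
      rw [Set.indicator_of_notMem (by simpa using hx), Set.indicator_of_notMem h1]
  have hm : Measurable (R.indicator fun z => G z.1 z.2) := hG.indicator hR
  rw [← lintegral_indicator measurableSet_Ioi, ← lintegral_indicator measurableSet_Ioi]
  have e1 : ∀ x, (Set.Ioi (0 : ℝ)).indicator (fun x => ∫⁻ s in Set.Ioi (c / x), G x s) x =
      ∫⁻ s, R.indicator (fun z => G z.1 z.2) (x, s) := by
    intro x
    simp_rw [← key]
    by_cases hx : x ∈ Set.Ioi (0 : ℝ)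
    · simp_rw [Set.indicator_of_mem hx]
      rw [lintegral_indicator measurableSet_Ioi]
    · simp_rw [Set.indicator_of_notMem hx, lintegral_zero]
  have e2 : ∀ s, (Set.Ioi (0 : ℝ)).indicator (fun s => ∫⁻ x in Set.Ioi (c / s), G x s) s =
      ∫⁻ x, R.indicator (fun z => G z.1 z.2) (x, s) := by
    intro s
    simp_rw [← key']
    by_cases hx : s ∈ Set.Ioi (0 : ℝ)
    · simp_rw [Set.indicator_of_mem hx]
      rw [lintegral_indicator measurableSet_Ioi]
    · simp_rw [Set.indicator_of_notMem hx, lintegral_zero]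
  simp_rw [e1, e2]
  exact lintegral_lintegral_swap (f := fun x s => R.indicator (fun z => G z.1 z.2) (x, s))
    hm.aemeasurable

/-- Two vertices joined by an edge of weight `w` and joined to the root with weights `ea` and `eb`,
in the triangular coordinates `x` (diagonal entry of the second vertex) and `t` (Schur complement of
the first). The values `ψ = H⁻¹ η` at the two vertices are the arguments of `Φ`. In the coordinates
`s = ⟨η, H⁻¹ η⟩ = ea ψ₁ + eb ψ₂` and `r = ψ₁ / ψ₂`, the weight `w` enters only through the factor
`exp (-w)` and through the shape parameter `w + ea eb / s` of an inverse Gaussian law for `r`. -/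
theorem lintegral_two_vertices {ea eb w : ℝ} (hea : 0 ≤ ea) (heb : 0 ≤ eb) (hw : 0 ≤ w)
    (hq : 0 < ea ∨ 0 < w ∧ 0 < eb) (hk : 0 < w ∨ 0 < ea ∧ 0 < eb) {Φ : ℝ → ℝ → ℝ≥0∞}
    (hΦ : Measurable fun z : ℝ × ℝ => Φ z.1 z.2) :
    ∫⁻ x in Set.Ioi (0 : ℝ), ∫⁻ t in Set.Ioi (0 : ℝ),
        Φ ((ea + w * eb / x) / t) ((eb + w * ((ea + w * eb / x) / t)) / x) *
          ENNReal.ofReal (Real.exp (-(x + t + w ^ 2 / x + (eb ^ 2 / x + (ea + w * eb / x) ^ 2 / t))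
            / 2) / Real.sqrt (x * t)) =
      ENNReal.ofReal (Real.exp (-w)) * ∫⁻ s in Set.Ioi (0 : ℝ),
        ENNReal.ofReal (Real.exp (-(s + (ea + eb) ^ 2 / s) / 2) / (s * Real.sqrt s)) *
          igLintegral (w + ea * eb / s) (fun r =>
            ENNReal.ofReal (ea * r + eb) * Φ (s * r / (ea * r + eb)) (s / (ea * r + eb))) := by
  let F : ℝ → ℝ → ℝ≥0∞ := fun x t =>
    Φ ((ea + w * eb / x) / t) ((eb + w * ((ea + w * eb / x) / t)) / x) *
      ENNReal.ofReal (Real.exp (-(x + t + w ^ 2 / x + (eb ^ 2 / x + (ea + w * eb / x) ^ 2 / t))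
        / 2) / Real.sqrt (x * t))
  let G : ℝ → ℝ → ℝ≥0∞ := fun x s =>
    ENNReal.ofReal ((ea + w * eb / x) ^ 2 / (s - eb ^ 2 / x) ^ 2) *
      F x ((ea + w * eb / x) ^ 2 / (s - eb ^ 2 / x))
  have hF : Measurable fun z : ℝ × ℝ => F z.1 z.2 := by
    refine Measurable.mul ?_ (by fun_prop)
    exact hΦ.comp (f := fun z : ℝ × ℝ => ((ea + w * eb / z.1) / z.2,
      (eb + w * ((ea + w * eb / z.1) / z.2)) / z.1)) (by fun_prop)
  have hG : Measurable fun z : ℝ × ℝ => G z.1 z.2 := by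
    refine Measurable.mul (by fun_prop) ?_
    exact hF.comp (f := fun z : ℝ × ℝ => (z.1, (ea + w * eb / z.1) ^ 2 / (z.2 - eb ^ 2 / z.1)))
      (by fun_prop)
  have hqx : ∀ x, 0 < x → 0 < ea + w * eb / x := fun x hx => by
    rcases hq with h | ⟨h, h'⟩
    · have : 0 ≤ w * eb / x := by positivity
      linarith
    · have : 0 < w * eb / x := by positivity
      linarith
  have s1 : ∫⁻ x in Set.Ioi (0 : ℝ), ∫⁻ t in Set.Ioi (0 : ℝ), F x t =
      ∫⁻ x in Set.Ioi (0 : ℝ), ∫⁻ s in Set.Ioi (eb ^ 2 / x), G x s :=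
    setLIntegral_congr_fun measurableSet_Ioi fun x hx =>
      lintegral_comp_div_sub (pow_pos (hqx x hx) 2) _ _
  change ∫⁻ x in Set.Ioi (0 : ℝ), ∫⁻ t in Set.Ioi (0 : ℝ), F x t = _
  rw [s1, lintegral_hyperbola_swap (sq_nonneg eb) hG,
    ← lintegral_const_mul' _ _ ENNReal.ofReal_ne_top]
  refine setLIntegral_congr_fun measurableSet_Ioi fun s hs => ?_
  have hs' : (0 : ℝ) < s := hs
  set κ := w + ea * eb / s with hκ
  have hκ0 : 0 < κ := by
    rcases hk with h | ⟨h, h'⟩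
    · have : 0 ≤ ea * eb / s := by positivity
      linarith
    · have : 0 < ea * eb / s := by positivity
      linarith
  rw [lintegral_comp_add_mul hκ0, igLintegral, ← lintegral_const_mul' _ _ ENNReal.ofReal_ne_top,
    ← lintegral_const_mul' _ _ ENNReal.ofReal_ne_top]
  refine setLIntegral_congr_fun measurableSet_Ioi fun r hr => ?_
  have hr' : (0 : ℝ) < r := hr
  set D := ea * r + eb with hD
  have hD0 : 0 < D := by
    rcases hq with h | ⟨_, h⟩
    · have : 0 < ea * r := by positivity
      linarith
    · have : 0 ≤ ea * r := by positivity
      linarith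
  set x := eb ^ 2 / s + κ * r with hx
  have hx0 : 0 < x := by positivity
  have hxs : s * x = D * eb + w * s * r := by
    rw [hx, hκ, hD]; field_simp; ring
  have hws : w = κ - ea * eb / s := by rw [hκ]; ring
  have e1 : s - eb ^ 2 / x = s * κ * r / x := by
    rw [eq_div_iff hx0.ne', sub_mul, div_mul_cancel₀ _ hx0.ne', hx]; field_simp; ring
  have e2 : ea + w * eb / x = κ * D / x := by
    rw [eq_div_iff hx0.ne', add_mul, div_mul_cancel₀ _ hx0.ne', hx, hws, hD]; field_simp; ring
  have e3 : (κ * D / x) ^ 2 / (s * κ * r / x) = κ * D ^ 2 / (x * s * r) := by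
    field_simp
  have e4 : κ * D / x / (κ * D ^ 2 / (x * s * r)) = s * r / D := by
    field_simp
  have e5 : (eb + w * (s * r / D)) / x = s / D := by
    rw [div_eq_div_iff hx0.ne' hD0.ne', hxs]; field_simp
  have e6 : (κ * D / x) ^ 2 / (κ * D ^ 2 / (x * s * r)) = s - eb ^ 2 / x := by
    rw [e1]; field_simp
  have e7 : κ * D ^ 2 / (x * s * r) + w ^ 2 / x = ea ^ 2 / s + κ / r := by
    have h : κ * D ^ 2 + w ^ 2 * s * r = (ea ^ 2 * r + κ * s) * x := by
      rw [hx, hws, hD]; field_simp; ring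
    have h2 : κ * D ^ 2 / (x * s * r) + w ^ 2 / x = (κ * D ^ 2 + w ^ 2 * s * r) / (x * s * r) := by
      field_simp
    rw [h2, h]; field_simp
  have e8 : -(x + κ * D ^ 2 / (x * s * r) + w ^ 2 / x + (eb ^ 2 / x +
      (κ * D / x) ^ 2 / (κ * D ^ 2 / (x * s * r)))) / 2 =
      -w + (-(s + (ea + eb) ^ 2 / s) / 2 + -(κ / 2) * (r + 1 / r - 2)) := by
    rw [e6]
    have : x + κ * D ^ 2 / (x * s * r) + w ^ 2 / x + (eb ^ 2 / x + (s - eb ^ 2 / x)) =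
        x + (ea ^ 2 / s + κ / r) + s := by rw [← e7]; ring
    rw [this, hx, hκ]
    field_simp
    ring
  have e9 : Real.sqrt (x * (κ * D ^ 2 / (x * s * r))) =
      Real.sqrt κ * D / (Real.sqrt s * Real.sqrt r) := by
    have : x * (κ * D ^ 2 / (x * s * r)) = κ * D ^ 2 / (s * r) := by field_simp
    rw [this, Real.sqrt_div (by positivity), Real.sqrt_mul hκ0.le, Real.sqrt_sq hD0.le,
      Real.sqrt_mul hs'.le]
  simp only [G, F]
  rw [e1, e2, e3, e4, e5, e8, e9, mul_left_comm _ (Φ _ _), mul_left_comm _ (Φ _ _),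
    mul_comm (ENNReal.ofReal D), mul_assoc (Φ _ _), mul_left_comm _ (Φ _ _),
    mul_left_comm _ (Φ _ _), ← ENNReal.ofReal_mul (by positivity),
    ← ENNReal.ofReal_mul (by positivity), ← ENNReal.ofReal_mul (by positivity),
    ← ENNReal.ofReal_mul (by positivity), ← ENNReal.ofReal_mul (by positivity)]
  congr 2
  rw [Real.exp_add, Real.exp_add, ig]
  generalize Real.exp (-(κ / 2) * (r + 1 / r - 2)) = E1
  generalize Real.exp (-(s + (ea + eb) ^ 2 / s) / 2) = E2
  generalize Real.exp (-w) = E3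
  have hsk : Real.sqrt κ ^ 2 = κ := Real.sq_sqrt hκ0.le
  have hss : Real.sqrt s ^ 2 = s := Real.sq_sqrt hs'.le
  have hsr : Real.sqrt r ^ 2 = r := Real.sq_sqrt hr'.le
  have hsk0 : 0 < Real.sqrt κ := Real.sqrt_pos.2 hκ0
  have hss0 : 0 < Real.sqrt s := Real.sqrt_pos.2 hs'
  have hsr0 : 0 < Real.sqrt r := Real.sqrt_pos.2 hr'
  have j1 : κ * ((κ * D / x) ^ 2 / (s * κ * r / x) ^ 2) = κ * D ^ 2 / (s ^ 2 * r ^ 2) := by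
    field_simp
  rw [← mul_assoc, j1]
  generalize Real.sqrt κ = k' at *
  generalize Real.sqrt s = s' at *
  generalize Real.sqrt r = r' at *
  rw [← hsk, ← hss, ← hsr]
  field_simp

/-! ### Integration over the field, one vertex at a time -/

open Classical in
/-- The unnormalised density of the field with weights `W` and boundary term `η`, in the coordinates
`h = 2β`. -/
def dens (W : Matrix (Fin m) (Fin m) ℝ) (η h : Fin m → ℝ) : ℝ :=
  if (opMatrix W h).PosDef then
    Real.exp (-(∑ i, h i + green W h η η) / 2) / Real.sqrt (opMatrix W h).det
  else 0

/-- The logarithm of the normalising constant: the sum of all edge weights, including the edges to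
the root. -/
def logNorm (W : Matrix (Fin m) (Fin m) ℝ) (η : Fin m → ℝ) : ℝ :=
  ∑ i, η i + (∑ i, ∑ j, if i = j then 0 else W i j) / 2

/-- The integral of `φ ⟨X, H⁻¹ η⟩` against the field, up to the factor `(2π)^(m/2)`. -/
def fieldLintegral (W : Matrix (Fin m) (Fin m) ℝ) (η X : Fin m → ℝ) (φ : ℝ → ℝ≥0∞) : ℝ≥0∞ :=
  ENNReal.ofReal (Real.exp (logNorm W η)) *
    ∫⁻ h, φ (green W h X η) * ENNReal.ofReal (dens W η h)

theorem continuous_opMatrix (W : Matrix (Fin m) (Fin m) ℝ) : Continuous (opMatrix W) := by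
  refine continuous_matrix fun i j => ?_
  by_cases h : i = j
  · simp only [opMatrix, Matrix.of_apply, h, if_true]
    fun_prop
  · simp only [opMatrix, Matrix.of_apply, h, if_false]
    fun_prop

@[fun_prop]
theorem measurable_green (W : Matrix (Fin m) (Fin m) ℝ) (X Y : Fin m → ℝ) :
    Measurable fun h => green W h X Y := by
  have h1 : Continuous fun h => (opMatrix W h).det := (continuous_opMatrix W).matrix_det
  have h2 : Continuous fun h => X ⬝ᵥ ((opMatrix W h).adjugate *ᵥ Y) :=
    Continuous.dotProduct continuous_const
      ((continuous_opMatrix W).matrix_adjugate.matrix_mulVec continuous_const)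
  have : (fun h => green W h X Y) =
      fun h => (opMatrix W h).det⁻¹ * (X ⬝ᵥ ((opMatrix W h).adjugate *ᵥ Y)) := by
    ext h
    rw [green, Matrix.inv_def, Matrix.smul_mulVec, dotProduct_smul, Ring.inverse_eq_inv,
      smul_eq_mul]
  rw [this]
  exact h1.measurable.inv.mul h2.measurable

theorem measurableSet_posDef {W : Matrix (Fin m) (Fin m) ℝ} (hW : W.IsSymm) :
    MeasurableSet {h | (opMatrix W h).PosDef} := by
  have e : {h | (opMatrix W h).PosDef} =
      (⋂ v : Fin m → ℝ, {h | 0 ≤ v ⬝ᵥ (opMatrix W h *ᵥ v)}) ∩ {h | (opMatrix W h).det ≠ 0} := by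
    ext h
    simp only [Set.mem_ofPred_eq, Set.mem_inter_iff, Set.mem_iInter]
    constructor
    · intro hp
      exact ⟨fun v => by simpa using hp.posSemidef.dotProduct_mulVec_nonneg v, hp.det_pos.ne'⟩
    · rintro ⟨h1, h2⟩
      have hps : (opMatrix W h).PosSemidef :=
        Matrix.PosSemidef.of_dotProduct_mulVec_nonneg (opMatrix_isHermitian hW h)
          fun v => by simpa using h1 v
      exact hps.posDef_iff_isUnit.2 ((Matrix.isUnit_iff_isUnit_det _).2 (isUnit_iff_ne_zero.2 h2))
  rw [e]
  refine (isClosed_iInter fun v => ?_).measurableSet.inter ?_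
  · exact isClosed_le continuous_const (Continuous.dotProduct continuous_const
      ((continuous_opMatrix W).matrix_mulVec continuous_const))
  · exact (isOpen_ne_fun (continuous_opMatrix W).matrix_det continuous_const).measurableSet

theorem measurable_dens {W : Matrix (Fin m) (Fin m) ℝ} (hW : W.IsSymm) (η : Fin m → ℝ) :
    Measurable (dens W η) := by
  unfold dens
  refine Measurable.ite (measurableSet_posDef hW) ?_ measurable_const
  have := ((continuous_opMatrix W).matrix_det).measurable
  fun_prop

@[fun_prop]
theorem measurable_schurDiag (W : Matrix (Fin (m + 1)) (Fin (m + 1)) ℝ) (p : Fin (m + 1)) :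
    Measurable fun z : ℝ × (Fin m → ℝ) => schurDiag W p z.1 z.2 := by
  refine measurable_pi_lambda _ fun j => ?_
  refine Fin.succAboveCases p ?_ (fun j => ?_) j
  · simp only [schurDiag, Fin.insertNth_apply_same]
    exact measurable_fst.add ((measurable_green _ _ _).comp measurable_snd)
  · simp only [schurDiag, Fin.insertNth_apply_succAbove]
    fun_prop

theorem lintegral_schurDiag (W : Matrix (Fin (m + 1)) (Fin (m + 1)) ℝ) (p : Fin (m + 1))
    {F : (Fin (m + 1) → ℝ) → ℝ≥0∞} (hF : Measurable F) :
    ∫⁻ h, F h = ∫⁻ h' : Fin m → ℝ, ∫⁻ x : ℝ, F (schurDiag W p x h') := by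
  have e := (volume_preserving_piFinSuccAbove (fun _ : Fin (m + 1) => ℝ) p).symm
  rw [← e.lintegral_comp hF]
  have hm : Measurable fun z : ℝ × (Fin m → ℝ) =>
      F ((MeasurableEquiv.piFinSuccAbove (fun _ : Fin (m + 1) => ℝ) p).symm z) :=
    hF.comp (MeasurableEquiv.measurable _)
  change ∫⁻ z, _ ∂((volume : Measure ℝ).prod (volume : Measure (Fin m → ℝ))) = _
  rw [lintegral_prod_symm' _ hm]
  refine lintegral_congr fun h' => ?_
  exact (lintegral_add_right_eq_self (μ := (volume : Measure ℝ)) (fun x =>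
    F ((MeasurableEquiv.piFinSuccAbove (fun _ : Fin (m + 1) => ℝ) p).symm (x, h'))) _).symm

theorem lintegral_eq_setLIntegral_Ioi {f : ℝ → ℝ≥0∞} (hf : ∀ x, x ≤ 0 → f x = 0) :
    ∫⁻ x, f x = ∫⁻ x in Set.Ioi (0 : ℝ), f x := by
  rw [← lintegral_indicator measurableSet_Ioi]
  refine lintegral_congr fun x => ?_
  by_cases hx : 0 < x
  · rw [Set.indicator_of_mem (Set.mem_Ioi.2 hx)]
  · rw [Set.indicator_of_notMem (by simpa using hx), hf x (not_lt.1 hx)]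

theorem sum_schurDiag (W : Matrix (Fin (m + 1)) (Fin (m + 1)) ℝ) (p : Fin (m + 1)) (x : ℝ)
    (h : Fin m → ℝ) :
    ∑ i, schurDiag W p x h i =
      x + green (delWeight W p) h (row W p) (row W p) + ∑ i, h i := by
  simp [Fin.sum_univ_succAbove _ p, schurDiag]

theorem dens_schurDiag {W : Matrix (Fin (m + 1)) (Fin (m + 1)) ℝ} (hW : W.IsSymm)
    (p : Fin (m + 1)) {x : ℝ} (hx : 0 < x) {h : Fin m → ℝ}
    (hpd : (opMatrix (delWeight W p) h).PosDef) (η : Fin (m + 1) → ℝ) :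
    dens W η (schurDiag W p x h) =
      Real.exp (-(x + (η p + green (delWeight W p) h (row W p) (η ∘ p.succAbove)) ^ 2 / x) / 2) /
        Real.sqrt x *
      (Real.exp (-(∑ i, h i + green (delWeight W p) h (row W p) (row W p) +
        green (delWeight W p) h (η ∘ p.succAbove) (η ∘ p.succAbove)) / 2) /
        Real.sqrt (opMatrix (delWeight W p) h).det) := by
  rw [dens, if_pos ((posDef_schurDiag_iff hW p x h).2 ⟨hx, hpd⟩), sum_schurDiag,
    green_schurDiag hW p hx hpd, det_schurDiag hW p hx hpd, Real.sqrt_mul hx.le,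
    div_mul_div_comm, ← Real.exp_add]
  congr 2
  ring

theorem dens_schurDiag_eq_zero {W : Matrix (Fin (m + 1)) (Fin (m + 1)) ℝ} (hW : W.IsSymm)
    (p : Fin (m + 1)) {x : ℝ} {h : Fin m → ℝ}
    (hh : ¬ (0 < x ∧ (opMatrix (delWeight W p) h).PosDef)) (η : Fin (m + 1) → ℝ) :
    dens W η (schurDiag W p x h) = 0 := by
  rw [dens, if_neg (fun h' => hh ((posDef_schurDiag_iff hW p x h).1 h'))]

theorem rooted_delWeight {W : Matrix (Fin (m + 1)) (Fin (m + 1)) ℝ} (hW : W.IsSymm)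
    (hnn : ∀ i j, i ≠ j → 0 ≤ W i j) {η : Fin (m + 1) → ℝ} (hη : ∀ j, 0 ≤ η j) (hr : Rooted W η)
    (p : Fin (m + 1)) : Rooted (delWeight W p) (η ∘ p.succAbove + row W p) := by
  intro A hA
  have hrow : ∀ j, 0 ≤ row W p j := fun j => hnn _ _ (Fin.succAbove_ne _ _).symm
  obtain ⟨_, ⟨j, hj, rfl⟩, hcut⟩ := hr (p.succAbove '' A) (hA.image _)
  refine ⟨j, hj, ?_⟩
  rcases hcut with h | ⟨k, hk, hWk⟩
  · exact Or.inl (add_pos_of_pos_of_nonneg h (hrow j))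
  · obtain rfl | ⟨k', rfl⟩ := Fin.eq_self_or_eq_succAbove p k
    · refine Or.inl (add_pos_of_nonneg_of_pos (hη _) ?_)
      rw [row, hW.apply]
      exact hWk
    · exact Or.inr ⟨k', fun h => hk ⟨k', h, rfl⟩, hWk⟩

theorem delWeight_nonneg {W : Matrix (Fin (m + 1)) (Fin (m + 1)) ℝ}
    (hnn : ∀ i j, i ≠ j → 0 ≤ W i j) (p : Fin (m + 1)) :
    ∀ i j, i ≠ j → 0 ≤ delWeight W p i j :=
  fun _ _ hij => hnn _ _ fun h => hij (Fin.succAbove_right_injective h)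

theorem row_nonneg {W : Matrix (Fin (m + 1)) (Fin (m + 1)) ℝ}
    (hnn : ∀ i j, i ≠ j → 0 ≤ W i j) (p : Fin (m + 1)) (j : Fin m) : 0 ≤ row W p j :=
  hnn _ _ (Fin.succAbove_ne _ _).symm

theorem logNorm_succ {W : Matrix (Fin (m + 1)) (Fin (m + 1)) ℝ} (hW : W.IsSymm)
    (η : Fin (m + 1) → ℝ) (p : Fin (m + 1)) :
    logNorm W η = η p + logNorm (delWeight W p) (η ∘ p.succAbove + row W p) := by
  have h : ∀ i, W (p.succAbove i) p = W p (p.succAbove i) := fun i => hW.apply _ _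
  simp only [logNorm, Fin.sum_univ_succAbove _ p, delWeight, row, Matrix.submatrix_apply,
    Pi.add_apply, Function.comp_apply, Finset.sum_add_distrib, if_true, Fin.succAbove_ne,
    (Fin.succAbove_ne p _).symm, if_false, Fin.succAbove_right_inj, h]
  ring

theorem add_green_row_pos {W : Matrix (Fin (m + 1)) (Fin (m + 1)) ℝ} (hW : W.IsSymm)
    (hnn : ∀ i j, i ≠ j → 0 ≤ W i j) {η : Fin (m + 1) → ℝ} (hη : ∀ j, 0 ≤ η j) (hr : Rooted W η)
    (p : Fin (m + 1)) {h : Fin m → ℝ} (hpd : (opMatrix (delWeight W p) h).PosDef) :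
    0 < η p + green (delWeight W p) h (row W p) (η ∘ p.succAbove) := by
  have h1 := green_single_pos hW hnn hη hr ((posDef_schurDiag_iff hW p 1 h).2 ⟨one_pos, hpd⟩) p
  rw [green_schurDiag hW p one_pos hpd, single_comp_succAbove] at h1
  simpa using h1

/-- Given the rest of the field, `⟨X, H⁻¹ η⟩` is an affine function of an inverse Gaussian variable
attached to the vertex `p`. Integrating out `p` turns `η` into `η + row W p`. -/
theorem fieldLintegral_vertex {W : Matrix (Fin (m + 1)) (Fin (m + 1)) ℝ} (hW : W.IsSymm)
    (hnn : ∀ i j, i ≠ j → 0 ≤ W i j) {η : Fin (m + 1) → ℝ} (hη : ∀ j, 0 ≤ η j) (hr : Rooted W η)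
    (X : Fin (m + 1) → ℝ) {φ : ℝ → ℝ≥0∞} (hφ : Measurable φ) (p : Fin (m + 1)) :
    fieldLintegral W η X φ =
      ENNReal.ofReal (Real.exp (logNorm (delWeight W p) (η ∘ p.succAbove + row W p))) *
        ∫⁻ h, igLintegral (η p + green (delWeight W p) h (row W p) (η ∘ p.succAbove))
          (fun r => φ (green (delWeight W p) h (X ∘ p.succAbove) (η ∘ p.succAbove) +
            (X p + green (delWeight W p) h (row W p) (X ∘ p.succAbove)) * r)) *
          ENNReal.ofReal (dens (delWeight W p) (η ∘ p.succAbove + row W p) h) := by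
  have hm : Measurable fun h => φ (green W h X η) * ENNReal.ofReal (dens W η h) :=
    (hφ.comp (measurable_green W X η)).mul (measurable_dens hW η).ennreal_ofReal
  rw [fieldLintegral, lintegral_schurDiag W p hm, logNorm_succ hW η p, add_comm (η p), Real.exp_add,
    ENNReal.ofReal_mul (Real.exp_pos _).le, mul_assoc]
  congr 1
  rw [← lintegral_const_mul' _ _ ENNReal.ofReal_ne_top]
  refine lintegral_congr fun h => ?_
  by_cases hpd : (opMatrix (delWeight W p) h).PosDef
  swap
  · have hz : ∀ x, dens W η (schurDiag W p x h) = 0 := fun x =>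
      dens_schurDiag_eq_zero hW p (fun h => hpd h.2) η
    simp only [hz]
    simp [dens, if_neg hpd]
  set y := η p + green (delWeight W p) h (row W p) (η ∘ p.succAbove) with hy
  set x' := X p + green (delWeight W p) h (row W p) (X ∘ p.succAbove) with hx'
  set g := green (delWeight W p) h (X ∘ p.succAbove) (η ∘ p.succAbove) with hg
  have hy0 : 0 < y := add_green_row_pos hW hnn hη hr p hpd
  rw [lintegral_eq_setLIntegral_Ioi fun x hx => by
    simp [dens_schurDiag_eq_zero hW p (fun h => absurd h.1 (not_lt.2 hx))]]
  set P := Real.exp (-(∑ i, h i + green (delWeight W p) h (row W p) (row W p) +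
        green (delWeight W p) h (η ∘ p.succAbove) (η ∘ p.succAbove)) / 2) /
        Real.sqrt (opMatrix (delWeight W p) h).det with hP
  have hP0 : 0 ≤ P := by positivity
  have hdens : dens (delWeight W p) (η ∘ p.succAbove + row W p) h =
      Real.exp (η p) * (P * Real.exp (-y)) := by
    rw [dens, if_pos hpd, hP, hy, green_add_left, green_add_right, green_add_right,
      green_comm (delWeight_isSymm hW p) h (η ∘ p.succAbove) (row W p), div_mul_eq_mul_div,
      mul_div_assoc', ← Real.exp_add, ← Real.exp_add]
    congr 2
    ring
  have hint : ∀ x ∈ Set.Ioi (0 : ℝ),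
      φ (green W (schurDiag W p x h) X η) * ENNReal.ofReal (dens W η (schurDiag W p x h)) =
      ENNReal.ofReal P * (φ (g + x' * (y / x)) *
        ENNReal.ofReal (Real.exp (-(x + y ^ 2 / x) / 2) / Real.sqrt x)) := fun x hx => by
    have hx0 : (0 : ℝ) < x := hx
    rw [green_schurDiag hW p hx0 hpd, dens_schurDiag hW p hx0 hpd, ← hP, ← hy, ← hx', ← hg,
      mul_div_assoc, mul_comm _ P, ENNReal.ofReal_mul hP0, mul_left_comm]
  rw [setLIntegral_congr_fun measurableSet_Ioi hint, lintegral_const_mul' _ _ ENNReal.ofReal_ne_top,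
    lintegral_eq_igLintegral hy0 (fun r => φ (g + x' * r)), hdens,
    ENNReal.ofReal_mul (Real.exp_pos _).le, ENNReal.ofReal_mul hP0]
  ring

/-- The mass and the first moment of `⟨X, H⁻¹ η⟩` do not depend on the weights. They are computed by
induction: a vertex is integrated out by replacing its inverse Gaussian variable by the mean `1`. -/
theorem fieldLintegral_affine : ∀ {m : ℕ} {W : Matrix (Fin m) (Fin m) ℝ}, W.IsSymm →
    (∀ i j, i ≠ j → 0 ≤ W i j) → ∀ {η : Fin m → ℝ}, (∀ j, 0 ≤ η j) → Rooted W η →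
    ∀ {X : Fin m → ℝ}, (∀ j, 0 ≤ X j) → ∀ {A B : ℝ}, 0 ≤ A → 0 ≤ B →
    fieldLintegral W η X (fun z => ENNReal.ofReal (A + B * z)) =
      ENNReal.ofReal (A + B * ∑ j, X j) * ENNReal.ofReal (Real.sqrt (2 * Real.pi)) ^ m
  | 0, W, hW, hnn, η, hη, hr, X, hX, A, B, hA, hB => by
    have hpd : ∀ h, (opMatrix W h).PosDef := fun h =>
      Matrix.PosDef.of_dotProduct_mulVec_pos (opMatrix_isHermitian hW h)
        fun v hv => absurd (Subsingleton.elim v 0) hv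
    have h1 : ∀ h, dens W η h = 1 := fun h => by simp [dens, hpd h, green]
    simp [fieldLintegral, h1, green, logNorm, volume_pi]
  | m + 1, W, hW, hnn, η, hη, hr, X, hX, A, B, hA, hB => by
    have hW' := delWeight_isSymm hW 0
    have hnn' := delWeight_nonneg hnn 0
    have hrow := row_nonneg hnn 0
    rw [fieldLintegral_vertex hW hnn hη hr X (by fun_prop) 0]
    set W' := delWeight W 0
    set η' := η ∘ Fin.succAbove 0 with hη'
    set X' := X ∘ Fin.succAbove 0 with hX'
    have hη0 : ∀ j, 0 ≤ η' j := fun j => hη _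
    have hX0 : ∀ j, 0 ≤ X' j := fun j => hX _
    have key := fieldLintegral_affine hW' hnn' (η := η' + row W 0)
      (fun j => add_nonneg (hη0 j) (hrow j)) (rooted_delWeight hW hnn hη hr 0) hX0
      (A := A + B * X 0) (B := B) (add_nonneg hA (mul_nonneg hB (hX 0))) hB
    have hsum : A + B * ∑ j, X j = A + B * X 0 + B * ∑ j, X' j := by
      rw [Fin.sum_univ_succAbove _ 0, hX']
      simp only [Function.comp_apply]
      ring
    rw [hsum, pow_succ, ← mul_assoc, ← key, fieldLintegral, mul_assoc]
    congr 1
    rw [← lintegral_mul_const' _ _ ENNReal.ofReal_ne_top]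
    refine lintegral_congr fun h => ?_
    by_cases hpd : (opMatrix W' h).PosDef
    swap
    · simp only [dens, if_neg hpd]
      simp
    have hy0 : 0 < η 0 + green W' h (row W 0) η' := add_green_row_pos hW hnn hη hr 0 hpd
    have hg0 : 0 ≤ green W' h X' η' := green_nonneg hW' hnn' hpd hX0 hη0
    have hx0 : 0 ≤ X 0 + green W' h (row W 0) X' :=
      add_nonneg (hX 0) (green_nonneg hW' hnn' hpd hrow hX0)
    have e : (fun r : ℝ => ENNReal.ofReal (A + B * (green W' h X' η' +
        (X 0 + green W' h (row W 0) X') * r))) = fun r => ENNReal.ofReal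
          ((A + B * green W' h X' η') + (B * (X 0 + green W' h (row W 0) X')) * r) := by
      ext r; congr 1; ring
    rw [e, igLintegral_affine hy0 (by positivity) (by positivity), green_add_right,
      green_comm hW' h (row W 0) X', mul_right_comm]
    congr 3
    ring

theorem convexOn_comp_add_mul {f : ℝ → ℝ} (hf : ConvexOn ℝ (Set.Ici 0) f) {c d : ℝ} (hc : 0 ≤ c)
    (hd : 0 ≤ d) : ConvexOn ℝ (Set.Ici 0) fun r => f (c + d * r) := by
  refine ⟨convex_Ici 0, fun x hx y hy s t hs ht hst => ?_⟩
  have hx' : (0 : ℝ) ≤ x := hx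
  have hy' : (0 : ℝ) ≤ y := hy
  have h := hf.2 (x := c + d * x) (y := c + d * y) (by simp; positivity) (by simp; positivity)
    hs ht hst
  have e : c + d * (s • x + t • y) = s • (c + d * x) + t • (c + d * y) := by
    simp only [smul_eq_mul]
    linear_combination (-c) * hst
  simp only [e]
  exact h

/-- Monotonicity in the weight of an edge to the root, which is the shape parameter of the inverse
Gaussian law in `fieldLintegral_vertex`, up to a term that does not involve it. -/
theorem fieldLintegral_anti_root {W : Matrix (Fin m) (Fin m) ℝ} (hW : W.IsSymm)
    (hnn : ∀ i j, i ≠ j → 0 ≤ W i j) {η η' : Fin m → ℝ} (hη : ∀ j, 0 ≤ η j) (hr : Rooted W η)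
    (p : Fin m) (hp : η p ≤ η' p) (hne : ∀ j, j ≠ p → η' j = η j)
    {X : Fin m → ℝ} (hX : ∀ j, 0 ≤ X j) {f : ℝ → ℝ} (hf : ConvexOn ℝ (Set.Ici 0) f)
    (hf0 : ∀ z, 0 ≤ z → 0 ≤ f z) (hfm : Measurable f) :
    fieldLintegral W η' X (fun z => ENNReal.ofReal (f z)) ≤
      fieldLintegral W η X (fun z => ENNReal.ofReal (f z)) := by
  obtain _ | m := m
  · exact p.elim0
  have hle : ∀ j, η j ≤ η' j := fun j => by
    by_cases h : j = p
    · exact h ▸ hp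
    · exact (hne j h).ge
  have hr' : Rooted W η' := hr.mono (fun _ _ => le_rfl) hle
  have hcomp : η' ∘ p.succAbove = η ∘ p.succAbove :=
    funext fun j => hne _ (Fin.succAbove_ne p j)
  rw [fieldLintegral_vertex hW hnn (fun j => (hη j).trans (hle j)) hr' X (by fun_prop) p,
    fieldLintegral_vertex hW hnn hη hr X (by fun_prop) p, hcomp]
  gcongr _ * ?_
  refine lintegral_mono fun h => ?_
  by_cases hpd : (opMatrix (delWeight W p) h).PosDef
  swap
  · simp only [dens, if_neg hpd]
    simp
  gcongr ?_ * _
  have hW' := delWeight_isSymm hW p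
  have hnn' := delWeight_nonneg hnn p
  have hrow := row_nonneg hnn p
  have hX' : ∀ j, 0 ≤ (X ∘ p.succAbove) j := fun j => hX _
  have hg0 := green_nonneg hW' hnn' hpd hX' (fun j => hη (p.succAbove j))
  have hx0 := add_nonneg (hX p) (green_nonneg hW' hnn' hpd hrow hX')
  exact igLintegral_anti ((convexOn_comp_add_mul hf hg0 hx0).subset Set.Ioi_subset_Ici_self
    (convex_Ioi 0))
    (fun r hr => hf0 _ (add_nonneg hg0 (mul_nonneg hx0 hr.le)))
    (add_green_row_pos hW hnn hη hr p hpd) (by gcongr)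

/-! ### Monotonicity in the weight of an edge -/

/-- The perspective of a convex function is convex. -/
theorem convexOn_perspective {f : ℝ → ℝ} (hf : ConvexOn ℝ (Set.Ici 0) f) {c s ea eb xa xb : ℝ}
    (hc : 0 ≤ c) (hs : 0 ≤ s) (hxa : 0 ≤ xa) (hxb : 0 ≤ xb)
    (hD : ∀ r : ℝ, 0 < r → 0 < ea * r + eb) :
    ConvexOn ℝ (Set.Ioi 0) fun r =>
      (ea * r + eb) * f (c + xa * (s * r / (ea * r + eb)) + xb * (s / (ea * r + eb))) := by
  refine ⟨convex_Ioi 0, fun x hx y hy a b ha hb hab => ?_⟩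
  have hx' : (0 : ℝ) < x := hx
  have hy' : (0 : ℝ) < y := hy
  have hz : 0 < a * x + b * y := (convex_Ioi (0 : ℝ)) hx hy ha hb hab
  simp only [smul_eq_mul]
  set D₁ := ea * x + eb with h₁
  set D₂ := ea * y + eb with h₂
  set D := ea * (a * x + b * y) + eb with h₃
  have hD₁ : 0 < D₁ := hD x hx'
  have hD₂ : 0 < D₂ := hD y hy'
  have hD₃ : 0 < D := hD _ hz
  have hDe : D = a * D₁ + b * D₂ := by rw [h₁, h₂, h₃]; linear_combination (-eb) * hab
  have m₁ : 0 ≤ c + xa * (s * x / D₁) + xb * (s / D₁) := by positivity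
  have m₂ : 0 ≤ c + xa * (s * y / D₂) + xb * (s / D₂) := by positivity
  have hw₁ : 0 ≤ a * D₁ / D := by positivity
  have hw₂ : 0 ≤ b * D₂ / D := by positivity
  have h := hf.2 m₁ m₂ hw₁ hw₂ (by rw [← add_div, ← hDe, div_self hD₃.ne'])
  simp only [smul_eq_mul] at h
  have e : a * D₁ / D * (c + xa * (s * x / D₁) + xb * (s / D₁)) +
      b * D₂ / D * (c + xa * (s * y / D₂) + xb * (s / D₂)) =
      c + xa * (s * (a * x + b * y) / D) + xb * (s / D) := by
    have hc' : c = c * ((a * D₁ + b * D₂) / D) := by rw [← hDe, div_self hD₃.ne', mul_one]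
    have hs' : xb * (s / D) = xb * ((a + b) * s / D) := by rw [hab, one_mul]
    rw [hs']
    conv_rhs => rw [hc']
    field_simp
    ring
  rw [e] at h
  calc D * f (c + xa * (s * (a * x + b * y) / D) + xb * (s / D)) ≤ D * _ :=
        mul_le_mul_of_nonneg_left h hD₃.le
    _ = _ := by field_simp

variable {k : ℕ}

/-- The weights of the graph with the vertices `a` and `a.succAbove b` removed. -/
def delWeight₂ (W : Matrix (Fin (k + 2)) (Fin (k + 2)) ℝ) (a : Fin (k + 2)) (b : Fin (k + 1)) :
    Matrix (Fin k) (Fin k) ℝ :=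
  delWeight (delWeight W a) b

/-- The restriction of a vector to the vertices other than `a` and `a.succAbove b`. -/
def restrict₂ (a : Fin (k + 2)) (b : Fin (k + 1)) (X : Fin (k + 2) → ℝ) : Fin k → ℝ :=
  (X ∘ a.succAbove) ∘ b.succAbove

/-- The weights of the edges from `a` to the vertices other than `a.succAbove b`. -/
def fstRow (W : Matrix (Fin (k + 2)) (Fin (k + 2)) ℝ) (a : Fin (k + 2)) (b : Fin (k + 1)) :
    Fin k → ℝ :=
  row W a ∘ b.succAbove

/-- The weights of the edges from `a.succAbove b` to the vertices other than `a`. -/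
def sndRow (W : Matrix (Fin (k + 2)) (Fin (k + 2)) ℝ) (a : Fin (k + 2)) (b : Fin (k + 1)) :
    Fin k → ℝ :=
  row (delWeight W a) b

/-- The entry at `a` of the vector induced by `X` on `{a, a.succAbove b}` by elimination of all
other vertices, where `h` is the diagonal of the matrix at the latter. -/
def fstVal (W : Matrix (Fin (k + 2)) (Fin (k + 2)) ℝ) (a : Fin (k + 2)) (b : Fin (k + 1))
    (h : Fin k → ℝ) (X : Fin (k + 2) → ℝ) : ℝ :=
  X a + green (delWeight₂ W a b) h (fstRow W a b) (restrict₂ a b X)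

/-- The entry at `a.succAbove b` of the vector induced by `X` on `{a, a.succAbove b}`. -/
def sndVal (W : Matrix (Fin (k + 2)) (Fin (k + 2)) ℝ) (a : Fin (k + 2)) (b : Fin (k + 1))
    (h : Fin k → ℝ) (X : Fin (k + 2) → ℝ) : ℝ :=
  X (a.succAbove b) + green (delWeight₂ W a b) h (sndRow W a b) (restrict₂ a b X)

/-- The weight of the edge between `a` and `a.succAbove b` after elimination of all other vertices:
the original weight increased by the contribution of the paths through the other vertices. -/
def edgeWeight (W : Matrix (Fin (k + 2)) (Fin (k + 2)) ℝ) (a : Fin (k + 2)) (b : Fin (k + 1))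
    (h : Fin k → ℝ) : ℝ :=
  W a (a.succAbove b) + green (delWeight₂ W a b) h (sndRow W a b) (fstRow W a b)

/-- The factor of the density that involves only the diagonal `h` at the vertices other than `a` and
`a.succAbove b`. -/
def restDens (W : Matrix (Fin (k + 2)) (Fin (k + 2)) ℝ) (a : Fin (k + 2)) (b : Fin (k + 1))
    (η : Fin (k + 2) → ℝ) (h : Fin k → ℝ) : ℝ :=
  Real.exp (-(∑ i, h i + green (delWeight₂ W a b) h (fstRow W a b) (fstRow W a b) +
    green (delWeight₂ W a b) h (sndRow W a b) (sndRow W a b) +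
    green (delWeight₂ W a b) h (restrict₂ a b η) (restrict₂ a b η)) / 2) /
    Real.sqrt (opMatrix (delWeight₂ W a b) h).det

theorem green_schurDiag_schurDiag {W : Matrix (Fin (k + 2)) (Fin (k + 2)) ℝ} (hW : W.IsSymm)
    (a : Fin (k + 2)) (b : Fin (k + 1)) {x t : ℝ} (hx : 0 < x) (ht : 0 < t) {h : Fin k → ℝ}
    (hpd : (opMatrix (delWeight₂ W a b) h).PosDef) (X Y : Fin (k + 2) → ℝ) :
    green W (schurDiag W a t (schurDiag (delWeight W a) b x h)) X Y =
      green (delWeight₂ W a b) h (restrict₂ a b X) (restrict₂ a b Y) +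
        fstVal W a b h X * ((fstVal W a b h Y + edgeWeight W a b h * sndVal W a b h Y / x) / t) +
        sndVal W a b h X * ((sndVal W a b h Y + edgeWeight W a b h *
          ((fstVal W a b h Y + edgeWeight W a b h * sndVal W a b h Y / x) / t)) / x) := by
  have hW₁ := delWeight_isSymm hW a
  have hpd₁ := (posDef_schurDiag_iff hW₁ b x h).2 ⟨hx, hpd⟩
  have h1 : ∀ Z : Fin (k + 2) → ℝ,
      Z a + (green (delWeight₂ W a b) h (fstRow W a b) (restrict₂ a b Z) +
        edgeWeight W a b h * sndVal W a b h Z / x) =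
      fstVal W a b h Z + edgeWeight W a b h * sndVal W a b h Z / x := fun Z => by
    rw [fstVal]; ring
  rw [green_schurDiag hW a ht hpd₁, green_schurDiag hW₁ b hx hpd, green_schurDiag hW₁ b hx hpd,
    green_schurDiag hW₁ b hx hpd]
  change green (delWeight₂ W a b) h (restrict₂ a b X) (restrict₂ a b Y) +
    sndVal W a b h X * sndVal W a b h Y / x +
    (X a + (green (delWeight₂ W a b) h (fstRow W a b) (restrict₂ a b X) +
      edgeWeight W a b h * sndVal W a b h X / x)) *
    (Y a + (green (delWeight₂ W a b) h (fstRow W a b) (restrict₂ a b Y) +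
      edgeWeight W a b h * sndVal W a b h Y / x)) / t = _
  rw [h1, h1]
  field_simp
  ring

theorem dens_schurDiag_schurDiag {W : Matrix (Fin (k + 2)) (Fin (k + 2)) ℝ} (hW : W.IsSymm)
    (a : Fin (k + 2)) (b : Fin (k + 1)) {x t : ℝ} (hx : 0 < x) (ht : 0 < t) {h : Fin k → ℝ}
    (hpd : (opMatrix (delWeight₂ W a b) h).PosDef) (η : Fin (k + 2) → ℝ) :
    dens W η (schurDiag W a t (schurDiag (delWeight W a) b x h)) =
      restDens W a b η h *
      (Real.exp (-(x + t + edgeWeight W a b h ^ 2 / x + (sndVal W a b h η ^ 2 / x +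
        (fstVal W a b h η + edgeWeight W a b h * sndVal W a b h η / x) ^ 2 / t)) / 2) /
        Real.sqrt (x * t)) := by
  have hW₁ := delWeight_isSymm hW a
  have hpd₁ := (posDef_schurDiag_iff hW₁ b x h).2 ⟨hx, hpd⟩
  rw [dens_schurDiag hW a ht hpd₁, green_schurDiag hW₁ b hx hpd, green_schurDiag hW₁ b hx hpd,
    green_schurDiag hW₁ b hx hpd, sum_schurDiag, det_schurDiag hW₁ b hx hpd, Real.sqrt_mul hx.le,
    Real.sqrt_mul hx.le]
  change Real.exp (-(t + (η a + (green (delWeight₂ W a b) h (fstRow W a b) (restrict₂ a b η) +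
    edgeWeight W a b h * sndVal W a b h η / x)) ^ 2 / t) / 2) / Real.sqrt t *
    (Real.exp (-(x + green (delWeight₂ W a b) h (sndRow W a b) (sndRow W a b) + ∑ i, h i +
      (green (delWeight₂ W a b) h (fstRow W a b) (fstRow W a b) +
        edgeWeight W a b h * edgeWeight W a b h / x) +
      (green (delWeight₂ W a b) h (restrict₂ a b η) (restrict₂ a b η) +
        sndVal W a b h η * sndVal W a b h η / x)) / 2) /
      (Real.sqrt x * Real.sqrt (opMatrix (delWeight₂ W a b) h).det)) = _
  rw [restDens, div_mul_div_comm, div_mul_div_comm, ← Real.exp_add, ← Real.exp_add]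
  congr 1
  · congr 1
    rw [fstVal]
    ring
  · ring

theorem green_delWeight₂_nonneg {W : Matrix (Fin (k + 2)) (Fin (k + 2)) ℝ} (hW : W.IsSymm)
    (hnn : ∀ i j, i ≠ j → 0 ≤ W i j) {a : Fin (k + 2)} {b : Fin (k + 1)} {h : Fin k → ℝ}
    (hpd : (opMatrix (delWeight₂ W a b) h).PosDef) {X Y : Fin k → ℝ} (hX : ∀ j, 0 ≤ X j)
    (hY : ∀ j, 0 ≤ Y j) : 0 ≤ green (delWeight₂ W a b) h X Y :=
  green_nonneg (delWeight_isSymm (delWeight_isSymm hW a) b)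
    (delWeight_nonneg (delWeight_nonneg hnn a) b) hpd hX hY

theorem fstRow_nonneg {W : Matrix (Fin (k + 2)) (Fin (k + 2)) ℝ} (hnn : ∀ i j, i ≠ j → 0 ≤ W i j)
    (a : Fin (k + 2)) (b : Fin (k + 1)) (j : Fin k) : 0 ≤ fstRow W a b j :=
  row_nonneg hnn a _

theorem sndRow_nonneg {W : Matrix (Fin (k + 2)) (Fin (k + 2)) ℝ} (hnn : ∀ i j, i ≠ j → 0 ≤ W i j)
    (a : Fin (k + 2)) (b : Fin (k + 1)) (j : Fin k) : 0 ≤ sndRow W a b j :=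
  row_nonneg (delWeight_nonneg hnn a) b j

theorem fstVal_nonneg {W : Matrix (Fin (k + 2)) (Fin (k + 2)) ℝ} (hW : W.IsSymm)
    (hnn : ∀ i j, i ≠ j → 0 ≤ W i j) {a : Fin (k + 2)} {b : Fin (k + 1)} {h : Fin k → ℝ}
    (hpd : (opMatrix (delWeight₂ W a b) h).PosDef) {X : Fin (k + 2) → ℝ} (hX : ∀ j, 0 ≤ X j) :
    0 ≤ fstVal W a b h X :=
  add_nonneg (hX a) (green_delWeight₂_nonneg hW hnn hpd (fstRow_nonneg hnn a b) fun _ => hX _)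

theorem sndVal_nonneg {W : Matrix (Fin (k + 2)) (Fin (k + 2)) ℝ} (hW : W.IsSymm)
    (hnn : ∀ i j, i ≠ j → 0 ≤ W i j) {a : Fin (k + 2)} {b : Fin (k + 1)} {h : Fin k → ℝ}
    (hpd : (opMatrix (delWeight₂ W a b) h).PosDef) {X : Fin (k + 2) → ℝ} (hX : ∀ j, 0 ≤ X j) :
    0 ≤ sndVal W a b h X :=
  add_nonneg (hX _) (green_delWeight₂_nonneg hW hnn hpd (sndRow_nonneg hnn a b) fun _ => hX _)

theorem edgeWeight_nonneg {W : Matrix (Fin (k + 2)) (Fin (k + 2)) ℝ} (hW : W.IsSymm)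
    (hnn : ∀ i j, i ≠ j → 0 ≤ W i j) {a : Fin (k + 2)} {b : Fin (k + 1)} {h : Fin k → ℝ}
    (hpd : (opMatrix (delWeight₂ W a b) h).PosDef) : 0 ≤ edgeWeight W a b h :=
  add_nonneg (hnn _ _ (Fin.succAbove_ne _ _).symm)
    (green_delWeight₂_nonneg hW hnn hpd (sndRow_nonneg hnn a b) (fstRow_nonneg hnn a b))

/-- Elimination of vertices preserves connectedness to the root: the two remaining vertices and the
root form a connected graph with the effective weights. -/
theorem effective_weights_pos {W : Matrix (Fin (k + 2)) (Fin (k + 2)) ℝ} (hW : W.IsSymm)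
    (hnn : ∀ i j, i ≠ j → 0 ≤ W i j) {η : Fin (k + 2) → ℝ} (hη : ∀ j, 0 ≤ η j) (hr : Rooted W η)
    {a : Fin (k + 2)} {b : Fin (k + 1)} {h : Fin k → ℝ}
    (hpd : (opMatrix (delWeight₂ W a b) h).PosDef) :
    (0 < fstVal W a b h η ∨ 0 < edgeWeight W a b h ∧ 0 < sndVal W a b h η) ∧
      (0 < edgeWeight W a b h ∨ 0 < fstVal W a b h η ∧ 0 < sndVal W a b h η) := by
  have hea := fstVal_nonneg hW hnn hpd hη
  have heb := sndVal_nonneg hW hnn hpd hη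
  have hw := edgeWeight_nonneg hW hnn hpd
  have hpd₁ := (posDef_schurDiag_iff (delWeight_isSymm hW a) b 1 h).2 ⟨one_pos, hpd⟩
  have hpd₀ := (posDef_schurDiag_iff hW a 1 _).2 ⟨one_pos, hpd₁⟩
  have pa : 0 < fstVal W a b h η + edgeWeight W a b h * sndVal W a b h η := by
    have h1 := green_single_pos hW hnn hη hr hpd₀ a
    have h2 : restrict₂ a b (Pi.single a 1) = 0 := by
      rw [restrict₂, single_comp_succAbove]; rfl
    have h3 : fstVal W a b h (Pi.single a 1) = 1 := by rw [fstVal, h2]; simp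
    have h4 : sndVal W a b h (Pi.single a 1) = 0 := by rw [sndVal, h2]; simp
    rw [green_schurDiag_schurDiag hW a b one_pos one_pos hpd, h2, h3, h4] at h1
    simpa using h1
  have pb : 0 < sndVal W a b h η + edgeWeight W a b h *
      (fstVal W a b h η + edgeWeight W a b h * sndVal W a b h η) := by
    have h1 := green_single_pos hW hnn hη hr hpd₀ (a.succAbove b)
    have h2 : restrict₂ a b (Pi.single (a.succAbove b) 1) = 0 := by
      ext j
      simp [restrict₂]
    have h3 : fstVal W a b h (Pi.single (a.succAbove b) 1) = 0 := by
      rw [fstVal, h2, Pi.single_eq_of_ne (Fin.succAbove_ne a b).symm]; simp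
    have h4 : sndVal W a b h (Pi.single (a.succAbove b) 1) = 1 := by rw [sndVal, h2]; simp
    rw [green_schurDiag_schurDiag hW a b one_pos one_pos hpd, h2, h3, h4] at h1
    simpa using h1
  constructor
  · rcases hea.eq_or_lt with h0 | h0
    · rw [← h0, zero_add] at pa
      exact Or.inr ⟨pos_of_mul_pos_left pa heb, pos_of_mul_pos_right pa hw⟩
    · exact Or.inl h0
  · rcases hw.eq_or_lt with h0 | h0
    · rw [← h0] at pa pb
      exact Or.inr ⟨by linarith, by linarith⟩
    · exact Or.inl h0

/-- The field integral, when two vertices are integrated out first. The weight of the edge between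
them enters only through the shape parameter of the inverse Gaussian integral. -/
theorem fieldLintegral_edge {W : Matrix (Fin (k + 2)) (Fin (k + 2)) ℝ} (hW : W.IsSymm)
    (hnn : ∀ i j, i ≠ j → 0 ≤ W i j) {η : Fin (k + 2) → ℝ} (hη : ∀ j, 0 ≤ η j) (hr : Rooted W η)
    (X : Fin (k + 2) → ℝ) {φ : ℝ → ℝ≥0∞} (hφ : Measurable φ) (a : Fin (k + 2)) (b : Fin (k + 1)) :
    fieldLintegral W η X φ =
      ENNReal.ofReal (Real.exp (η a + η (a.succAbove b) +
        logNorm (delWeight₂ W a b) (restrict₂ a b η + fstRow W a b + sndRow W a b))) *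
      ∫⁻ h, {h | (opMatrix (delWeight₂ W a b) h).PosDef}.indicator (fun h =>
        ENNReal.ofReal (restDens W a b η h) *
        (ENNReal.ofReal (Real.exp
          (-green (delWeight₂ W a b) h (sndRow W a b) (fstRow W a b))) *
        ∫⁻ s in Set.Ioi (0 : ℝ),
          ENNReal.ofReal (Real.exp (-(s + (fstVal W a b h η + sndVal W a b h η) ^ 2 / s) / 2) /
            (s * Real.sqrt s)) *
          igLintegral (edgeWeight W a b h + fstVal W a b h η * sndVal W a b h η / s) (fun q =>
            ENNReal.ofReal (fstVal W a b h η * q + sndVal W a b h η) *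
              φ (green (delWeight₂ W a b) h (restrict₂ a b X) (restrict₂ a b η) +
                fstVal W a b h X * (s * q / (fstVal W a b h η * q + sndVal W a b h η)) +
                sndVal W a b h X * (s / (fstVal W a b h η * q + sndVal W a b h η)))))) h := by
  have hW₁ := delWeight_isSymm hW a
  have hm : Measurable fun h => φ (green W h X η) * ENNReal.ofReal (dens W η h) :=
    (hφ.comp (measurable_green W X η)).mul (measurable_dens hW η).ennreal_ofReal
  have hm₁ : Measurable fun h₁ => ∫⁻ t : ℝ, φ (green W (schurDiag W a t h₁) X η) *
      ENNReal.ofReal (dens W η (schurDiag W a t h₁)) :=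
    Measurable.lintegral_prod_left' (f := fun z : ℝ × (Fin (k + 1) → ℝ) =>
      φ (green W (schurDiag W a z.1 z.2) X η) * ENNReal.ofReal (dens W η (schurDiag W a z.1 z.2)))
      (hm.comp (measurable_schurDiag W a))
  have hlog : logNorm W η = η a + η (a.succAbove b) +
      logNorm (delWeight₂ W a b) (restrict₂ a b η + fstRow W a b + sndRow W a b) +
      W a (a.succAbove b) := by
    rw [logNorm_succ hW η a, logNorm_succ hW₁ _ b]
    change η a + (η (a.succAbove b) + W a (a.succAbove b) +
      logNorm (delWeight₂ W a b) (restrict₂ a b η + fstRow W a b + sndRow W a b)) = _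
    ring
  rw [fieldLintegral, lintegral_schurDiag W a hm, lintegral_schurDiag (delWeight W a) b hm₁, hlog,
    Real.exp_add _ (W a (a.succAbove b)), ENNReal.ofReal_mul (Real.exp_pos _).le, mul_assoc]
  congr 1
  rw [← lintegral_const_mul' _ _ ENNReal.ofReal_ne_top]
  refine lintegral_congr fun h => ?_
  by_cases hpd : (opMatrix (delWeight₂ W a b) h).PosDef
  swap
  · have hz : ∀ x t, dens W η (schurDiag W a t (schurDiag (delWeight W a) b x h)) = 0 := fun x t =>
      dens_schurDiag_eq_zero hW a
        (fun h' => hpd ((posDef_schurDiag_iff hW₁ b x h).1 h'.2).2) η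
    rw [Set.indicator_of_notMem (by simpa using hpd)]
    simp only [hz]
    simp
  rw [Set.indicator_of_mem (by simpa using hpd)]
  obtain ⟨hq, hk⟩ := effective_weights_pos hW hnn hη hr hpd
  have hP0 : 0 ≤ restDens W a b η h := by unfold restDens; positivity
  have hzt : ∀ x t, t ≤ 0 → φ (green W (schurDiag W a t (schurDiag (delWeight W a) b x h)) X η) *
      ENNReal.ofReal (dens W η (schurDiag W a t (schurDiag (delWeight W a) b x h))) = 0 :=
    fun x t ht => by
      rw [dens_schurDiag_eq_zero hW a (fun h' => absurd h'.1 (not_lt.2 ht)), ENNReal.ofReal_zero,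
        mul_zero]
  have hzx : ∀ x, x ≤ 0 →
      ∫⁻ t : ℝ, φ (green W (schurDiag W a t (schurDiag (delWeight W a) b x h)) X η) *
        ENNReal.ofReal (dens W η (schurDiag W a t (schurDiag (delWeight W a) b x h))) = 0 :=
    fun x hx => by
      have hz : ∀ t, dens W η (schurDiag W a t (schurDiag (delWeight W a) b x h)) = 0 := fun t =>
        dens_schurDiag_eq_zero hW a
          (fun h' => absurd ((posDef_schurDiag_iff hW₁ b x h).1 h'.2).1 (not_lt.2 hx)) η
      simp only [hz]
      simp
  let Φ : ℝ → ℝ → ℝ≥0∞ := fun u v =>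
    φ (green (delWeight₂ W a b) h (restrict₂ a b X) (restrict₂ a b η) + fstVal W a b h X * u +
      sndVal W a b h X * v)
  have hΦ : Measurable fun z : ℝ × ℝ => Φ z.1 z.2 := hφ.comp (by fun_prop)
  have hinner : ∀ x ∈ Set.Ioi (0 : ℝ),
      ∫⁻ t : ℝ, φ (green W (schurDiag W a t (schurDiag (delWeight W a) b x h)) X η) *
        ENNReal.ofReal (dens W η (schurDiag W a t (schurDiag (delWeight W a) b x h))) =
      ENNReal.ofReal (restDens W a b η h) * ∫⁻ t in Set.Ioi (0 : ℝ),
        (Φ ((fstVal W a b h η + edgeWeight W a b h * sndVal W a b h η / x) / t)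
          ((sndVal W a b h η + edgeWeight W a b h *
            ((fstVal W a b h η + edgeWeight W a b h * sndVal W a b h η / x) / t)) / x) *
        ENNReal.ofReal (Real.exp (-(x + t + edgeWeight W a b h ^ 2 / x +
          (sndVal W a b h η ^ 2 / x +
            (fstVal W a b h η + edgeWeight W a b h * sndVal W a b h η / x) ^ 2 / t)) / 2) /
          Real.sqrt (x * t))) := by
    intro x hx
    rw [lintegral_eq_setLIntegral_Ioi (hzt x), ← lintegral_const_mul' _ _ ENNReal.ofReal_ne_top]
    refine setLIntegral_congr_fun measurableSet_Ioi fun t ht => ?_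
    rw [green_schurDiag_schurDiag hW a b hx ht hpd, dens_schurDiag_schurDiag hW a b hx ht hpd,
      ENNReal.ofReal_mul hP0, mul_left_comm]
  rw [lintegral_eq_setLIntegral_Ioi hzx, setLIntegral_congr_fun measurableSet_Ioi hinner,
    lintegral_const_mul' _ _ ENNReal.ofReal_ne_top,
    lintegral_two_vertices (fstVal_nonneg hW hnn hpd hη) (sndVal_nonneg hW hnn hpd hη)
      (edgeWeight_nonneg hW hnn hpd) hq hk hΦ]
  have hexp : Real.exp (-edgeWeight W a b h) * Real.exp (W a (a.succAbove b)) =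
      Real.exp (-green (delWeight₂ W a b) h (sndRow W a b) (fstRow W a b)) := by
    rw [← Real.exp_add, edgeWeight]
    congr 1
    ring
  rw [← hexp, ENNReal.ofReal_mul (Real.exp_pos _).le]
  simp only [Φ]
  ring

/-- Monotonicity in the weight of an edge between two vertices different from the root. The factor
`ea r + eb` in `lintegral_two_vertices` turns the convex function into its perspective, so that
`igLintegral_anti` applies. -/
theorem fieldLintegral_anti_edge {m : ℕ} {W W' : Matrix (Fin m) (Fin m) ℝ} (hW : W.IsSymm)
    (hW' : W'.IsSymm) (hnn : ∀ i j, i ≠ j → 0 ≤ W i j) {η : Fin m → ℝ} (hη : ∀ j, 0 ≤ η j)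
    (hr : Rooted W η) {a b : Fin m} (hab : a ≠ b) (hle : W a b ≤ W' a b)
    (heq : ∀ i j, s(i, j) ≠ s(a, b) → W' i j = W i j)
    {X : Fin m → ℝ} (hX : ∀ j, 0 ≤ X j) {f : ℝ → ℝ} (hf : ConvexOn ℝ (Set.Ici 0) f)
    (hf0 : ∀ z, 0 ≤ z → 0 ≤ f z) (hfm : Measurable f) :
    fieldLintegral W' η X (fun z => ENNReal.ofReal (f z)) ≤
      fieldLintegral W η X (fun z => ENNReal.ofReal (f z)) := by
  have hle' : ∀ i j, W i j ≤ W' i j := fun i j => by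
    by_cases h : s(i, j) = s(a, b)
    · rcases Sym2.eq_iff.1 h with ⟨rfl, rfl⟩ | ⟨rfl, rfl⟩
      · exact hle
      · rw [← hW.apply, ← hW'.apply]
        exact hle
    · exact (heq i j h).ge
  have hnn' : ∀ i j, i ≠ j → 0 ≤ W' i j := fun i j hij => (hnn i j hij).trans (hle' i j)
  have hr' : Rooted W' η := hr.mono hle' fun _ => le_rfl
  obtain _ | _ | k := m
  · exact a.elim0
  · exact absurd ((Fin.subsingleton_one).elim a b) hab
  obtain ⟨b, rfl⟩ := Fin.exists_succAbove_eq hab.symm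
  have eα : fstRow W' a b = fstRow W a b := by
    ext j
    refine heq _ _ fun h => ?_
    rcases Sym2.eq_iff.1 h with ⟨_, h⟩ | ⟨h, _⟩
    · exact Fin.succAbove_ne b j (Fin.succAbove_right_injective h)
    · exact Fin.succAbove_ne a b h.symm
  have eγ : sndRow W' a b = sndRow W a b := by
    ext j
    refine heq _ _ fun h => ?_
    rcases Sym2.eq_iff.1 h with ⟨h, _⟩ | ⟨_, h⟩
    · exact Fin.succAbove_ne a b h
    · exact Fin.succAbove_ne a _ h
  have e₂ : delWeight₂ W' a b = delWeight₂ W a b := by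
    ext i j
    refine heq _ _ fun h => ?_
    rcases Sym2.eq_iff.1 h with ⟨h, _⟩ | ⟨_, h⟩
    · exact Fin.succAbove_ne a _ h
    · exact Fin.succAbove_ne a _ h
  have eF : ∀ h Z, fstVal W' a b h Z = fstVal W a b h Z := fun h Z => by
    rw [fstVal, fstVal, e₂, eα]
  have eS : ∀ h Z, sndVal W' a b h Z = sndVal W a b h Z := fun h Z => by
    rw [sndVal, sndVal, e₂, eγ]
  have eR : ∀ h, restDens W' a b η h = restDens W a b η h := fun h => by
    rw [restDens, restDens, e₂, eα, eγ]
  have eW : ∀ h, edgeWeight W a b h ≤ edgeWeight W' a b h := fun h => by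
    rw [edgeWeight, edgeWeight, e₂, eα, eγ]
    gcongr
  rw [fieldLintegral_edge hW' hnn' hη hr' X (by fun_prop) a b,
    fieldLintegral_edge hW hnn hη hr X (by fun_prop) a b]
  simp only [e₂, eα, eγ, eF, eS, eR]
  gcongr _ * ?_
  refine lintegral_mono fun h => Set.indicator_le_indicator' fun hpd => ?_
  gcongr _ * (_ * ?_)
  refine setLIntegral_mono' measurableSet_Ioi fun s hs => ?_
  have hs' : (0 : ℝ) < s := hs
  gcongr _ * ?_
  have hpd' : (opMatrix (delWeight₂ W a b) h).PosDef := hpd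
  obtain ⟨hq, hk⟩ := effective_weights_pos hW hnn hη hr hpd'
  have hea := fstVal_nonneg hW hnn hpd' hη
  have heb := sndVal_nonneg hW hnn hpd' hη
  have hw := edgeWeight_nonneg hW hnn hpd'
  have hxa := fstVal_nonneg hW hnn hpd' hX
  have hxb := sndVal_nonneg hW hnn hpd' hX
  have hc : 0 ≤ green (delWeight₂ W a b) h (restrict₂ a b X) (restrict₂ a b η) :=
    green_delWeight₂_nonneg hW hnn hpd' (fun _ => hX _) (fun _ => hη _)
  have hD : ∀ q : ℝ, 0 < q → 0 < fstVal W a b h η * q + sndVal W a b h η := fun q hq' => by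
    rcases hq with h | ⟨_, h⟩
    · exact add_pos_of_pos_of_nonneg (mul_pos h hq') heb
    · exact add_pos_of_nonneg_of_pos (mul_nonneg hea hq'.le) h
  have hκ : 0 < edgeWeight W a b h + fstVal W a b h η * sndVal W a b h η / s := by
    rcases hk with h | ⟨h, h'⟩
    · exact add_pos_of_pos_of_nonneg h (div_nonneg (mul_nonneg hea heb) hs'.le)
    · exact add_pos_of_nonneg_of_pos hw (div_pos (mul_pos h h') hs')
  have key := igLintegral_anti (convexOn_perspective hf hc hs'.le hxa hxb hD)
    (fun q hq' => mul_nonneg (hD q hq').le (hf0 _ (by have := hD q hq'; positivity)))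
    hκ (add_le_add_left (eW h) (fstVal W a b h η * sndVal W a b h η / s))
  refine le_trans (le_of_eq ?_) (key.trans (le_of_eq ?_))
  all_goals
    refine setLIntegral_congr_fun measurableSet_Ioi fun q hq' => ?_
    beta_reduce
    rw [ENNReal.ofReal_mul (hD q hq').le]

/-! ### Reduction to the field without the root -/

theorem measurable_entry {n : ℕ} (i j : Fin n) :
    Measurable fun H : Matrix (Fin n) (Fin n) ℝ => H i j :=
  (measurable_pi_apply j).comp (measurable_pi_apply (X := fun _ : Fin n => Fin n → ℝ) i)

theorem measurable_det_comp {Ω : Type*} [MeasurableSpace Ω] {n : ℕ}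
    {A : Ω → Matrix (Fin n) (Fin n) ℝ} (hA : ∀ i j, Measurable fun ω => A ω i j) :
    Measurable fun ω => (A ω).det := by
  simp only [Matrix.det_apply]
  refine Finset.measurable_sum _ fun σ _ => ?_
  exact (Finset.measurable_prod _ fun i _ => hA _ _).const_smul _

theorem measurable_inv_entry {n : ℕ} (i j : Fin n) :
    Measurable fun H : Matrix (Fin n) (Fin n) ℝ => H⁻¹ i j := by
  have e : (fun H : Matrix (Fin n) (Fin n) ℝ => H⁻¹ i j) =
      fun H => H.det⁻¹ * (H.updateRow j (Pi.single i 1)).det := by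
    ext H
    rw [Matrix.inv_def, Matrix.smul_apply, Matrix.adjugate_apply, Ring.inverse_eq_inv, smul_eq_mul]
  rw [e]
  refine (measurable_det_comp measurable_entry).inv.mul (measurable_det_comp fun k l => ?_)
  by_cases h : k = j
  · subst h
    simp only [Matrix.updateRow_self]
    exact measurable_const
  · simp only [Matrix.updateRow_ne h]
    exact measurable_entry k l

@[fun_prop]
theorem measurable_ratio {n : ℕ} (X : Fin n → ℝ) (i : Fin n) :
    Measurable fun H => ratio H X i := by
  unfold ratio
  exact (Finset.measurable_sum _ fun j _ => (measurable_inv_entry i j).const_mul _).div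
    (measurable_inv_entry i i)

theorem measurable_opMatrix (W : Matrix (Fin m) (Fin m) ℝ) : Measurable (opMatrix W) := by
  refine measurable_pi_lambda (fun h i j => opMatrix W h i j) fun i =>
    measurable_pi_lambda _ fun j => ?_
  by_cases h : i = j
  · simp only [opMatrix, Matrix.of_apply, h, if_true]
    fun_prop
  · simp only [opMatrix, Matrix.of_apply, h, if_false]
    fun_prop

/-- The integral `∫₀^∞ x^(-1/2) e^(-x/2) dx`. -/
def gammaHalf : ℝ≥0∞ := ∫⁻ x in Set.Ioi (0 : ℝ), ENNReal.ofReal (Real.exp (-x / 2) / Real.sqrt x)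

theorem gammaHalf_ne_top : gammaHalf ≠ ∞ := by
  have h := integrableOn_rpow_mul_exp_neg_mul_rpow (s := -1 / 2) (p := 1) (b := 1 / 2) (by norm_num)
    one_pos (by norm_num)
  have h2 := h.2
  rw [hasFiniteIntegral_iff_ofReal] at h2
  · refine ne_of_lt (lt_of_eq_of_lt (setLIntegral_congr_fun measurableSet_Ioi fun x hx => ?_) h2)
    have hx' : (0 : ℝ) < x := hx
    congr 1
    rw [Real.rpow_one, show (-1 / 2 : ℝ) = -(1 / 2) by norm_num, Real.rpow_neg hx'.le,
      ← Real.sqrt_eq_rpow, div_eq_inv_mul]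
    congr 2
    ring
  · filter_upwards [ae_restrict_mem measurableSet_Ioi] with x hx
    have hx' : (0 : ℝ) < x := hx
    positivity

theorem ratio_schurDiag {W : Matrix (Fin (m + 1)) (Fin (m + 1)) ℝ} (hW : W.IsSymm)
    (i : Fin (m + 1)) {x : ℝ} (hx : 0 < x) {h : Fin m → ℝ}
    (hpd : (opMatrix (delWeight W i) h).PosDef) (X : Fin (m + 1) → ℝ) :
    ratio (opMatrix W (schurDiag W i x h)) X i =
      X i + green (delWeight W i) h (X ∘ i.succAbove) (row W i) := by
  have h1 : ∑ j, X j * (opMatrix W (schurDiag W i x h))⁻¹ i j =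
      green W (schurDiag W i x h) (Pi.single i 1) X := by
    rw [green_single_left, Matrix.mulVec, dotProduct]
    exact Finset.sum_congr rfl fun j _ => mul_comm _ _
  rw [ratio, h1, ← green_single_single, green_schurDiag hW i hx hpd, green_schurDiag hW i hx hpd,
    single_comp_succAbove, green_comm (delWeight_isSymm hW i) h (row W i) (X ∘ i.succAbove)]
  simp
  field_simp

/-- Integrating out the root. The ratio does not depend on the diagonal entry at the root, and the
edges to the root become the boundary term. -/
theorem lintegral_ratio_mul_dens {W : Matrix (Fin (m + 1)) (Fin (m + 1)) ℝ} (hW : W.IsSymm)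
    (i : Fin (m + 1)) (X : Fin (m + 1) → ℝ) {φ : ℝ → ℝ≥0∞} (hφ : Measurable φ) :
    ENNReal.ofReal (Real.exp (logNorm W 0)) *
      ∫⁻ h, φ (ratio (opMatrix W h) X i) * ENNReal.ofReal (dens W 0 h) =
      gammaHalf * fieldLintegral (delWeight W i) (row W i) (X ∘ i.succAbove)
        (fun z => φ (X i + z)) := by
  have hm : Measurable fun h => φ (ratio (opMatrix W h) X i) * ENNReal.ofReal (dens W 0 h) :=
    (hφ.comp ((measurable_ratio X i).comp (measurable_opMatrix W))).mul
      (measurable_dens hW 0).ennreal_ofReal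
  have hlog : logNorm W 0 = logNorm (delWeight W i) (row W i) := by
    rw [logNorm_succ hW 0 i, Pi.zero_apply, zero_add]
    congr 1
    ext j
    simp
  rw [lintegral_schurDiag W i hm, fieldLintegral, hlog, mul_left_comm]
  congr 1
  rw [← lintegral_const_mul' _ _ gammaHalf_ne_top]
  refine lintegral_congr fun h => ?_
  by_cases hpd : (opMatrix (delWeight W i) h).PosDef
  swap
  · have hz : ∀ x, dens W 0 (schurDiag W i x h) = 0 := fun x =>
      dens_schurDiag_eq_zero hW i (fun h => hpd h.2) 0
    simp only [hz]
    simp [dens, if_neg hpd]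
  rw [lintegral_eq_setLIntegral_Ioi fun x hx => by
    rw [dens_schurDiag_eq_zero hW i (fun h => absurd h.1 (not_lt.2 hx)), ENNReal.ofReal_zero,
      mul_zero]]
  rw [mul_comm gammaHalf, gammaHalf, ← lintegral_const_mul _ (by fun_prop)]
  refine setLIntegral_congr_fun measurableSet_Ioi fun x hx => ?_
  have hx' : (0 : ℝ) < x := hx
  have h0 : (0 : Fin (m + 1) → ℝ) ∘ i.succAbove = 0 := rfl
  rw [ratio_schurDiag hW i hx' hpd, dens_schurDiag hW i hx' hpd, h0, dens, if_pos hpd,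
    ENNReal.ofReal_mul (by positivity)]
  simp only [green_zero_right, Pi.zero_apply, add_zero]
  rw [mul_assoc, mul_comm (ENNReal.ofReal _) (ENNReal.ofReal _)]
  congr 3
  simp

theorem hMatrix_eq_opMatrix {n : ℕ} {W : Matrix (Fin n) (Fin n) ℝ} (hd : ∀ i, W i i = 0)
    (β : Fin n → ℝ) : hMatrix W β = opMatrix W ((2 : ℝ) • β) := by
  ext i j
  by_cases h : i = j
  · simp [hMatrix, opMatrix, h, hd]
  · simp [hMatrix, opMatrix, h]

theorem betaDensity_eq {n : ℕ} {W : Matrix (Fin n) (Fin n) ℝ} (hd : ∀ i, W i i = 0)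
    (β : Fin n → ℝ) :
    betaDensity W 0 β =
      (2 / Real.pi) ^ ((n : ℝ) / 2) * (Real.exp (logNorm W 0) * dens W 0 ((2 : ℝ) • β)) := by
  have hcond : ((∀ i, 0 < β i) ∧ (hMatrix W β).PosDef) ↔ (opMatrix W ((2 : ℝ) • β)).PosDef := by
    rw [hMatrix_eq_opMatrix hd]
    refine ⟨fun h => h.2, fun h => ⟨fun i => ?_, h⟩⟩
    have := h.diag_pos (i := i)
    simpa [opMatrix] using this
  rw [betaDensity, dens]
  by_cases hp : (opMatrix W ((2 : ℝ) • β)).PosDef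
  · rw [if_pos (hcond.2 hp), if_pos hp, mul_div_assoc, hMatrix_eq_opMatrix hd]
    congr 1
    rw [mul_div_assoc', ← Real.exp_add]
    congr 2
    have h1 : (1 : Fin n → ℝ) ⬝ᵥ (opMatrix W ((2 : ℝ) • β) *ᵥ 1) =
        ∑ i, ((2 : ℝ) • β) i - ∑ i, ∑ j, (if i = j then 0 else W i j) := by
      simp only [dotProduct, Matrix.mulVec, Pi.one_apply, one_mul, mul_one,
        ← Finset.sum_sub_distrib]
      refine Finset.sum_congr rfl fun i _ => ?_
      have h2 : ∀ j, opMatrix W ((2 : ℝ) • β) i j =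
          (if i = j then ((2 : ℝ) • β) i else 0) - (if i = j then 0 else W i j) := fun j => by
        by_cases h : i = j <;> simp [opMatrix, h]
      simp only [h2, Finset.sum_sub_distrib, Finset.sum_ite_eq, Finset.mem_univ, if_true]
    rw [h1, logNorm]
    simp
    ring
  · rw [if_neg (fun h => hp (hcond.1 h)), if_neg hp, mul_zero, mul_zero]

/-- The constant relating the law of the ratio to the reduced field, which does not depend on the
weights: the prefactor of the density, the Jacobian of `h = 2β`, and the integral at the root. -/
def lawConst (m : ℕ) : ℝ≥0∞ :=
  ENNReal.ofReal ((2 / Real.pi) ^ (((m + 1 : ℕ) : ℝ) / 2)) *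
    ENNReal.ofReal |((2 : ℝ) ^ Module.finrank ℝ (Fin (m + 1) → ℝ))⁻¹| * gammaHalf

theorem lawConst_ne_top (m : ℕ) : lawConst m ≠ ∞ := by
  have := gammaHalf_ne_top
  unfold lawConst
  finiteness

theorem lintegral_hLaw_eq {W : Matrix (Fin (m + 1)) (Fin (m + 1)) ℝ} (hW : W.IsSymm)
    (hW0 : ∀ i, W i i = 0) (i : Fin (m + 1)) (X : Fin (m + 1) → ℝ) {φ : ℝ → ℝ≥0∞}
    (hφ : Measurable φ) :
    ∫⁻ H, φ (ratio H X i) ∂(hLaw W 0) =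
      lawConst m *
        fieldLintegral (delWeight W i) (row W i) (X ∘ i.succAbove) (fun z => φ (X i + z)) := by
  have hmφ : Measurable fun H => φ (ratio H X i) := hφ.comp (measurable_ratio X i)
  have hmd : Measurable fun β => ENNReal.ofReal (betaDensity W 0 β) := by
    simp only [betaDensity_eq hW0]
    have := measurable_dens hW 0
    fun_prop
  have hG : Measurable fun h => φ (ratio (opMatrix W h) X i) * ENNReal.ofReal (dens W 0 h) :=
    (hmφ.comp (measurable_opMatrix W)).mul (measurable_dens hW 0).ennreal_ofReal
  have hpt : ∀ β : Fin (m + 1) → ℝ,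
      ENNReal.ofReal (betaDensity W 0 β) * φ (ratio (hMatrix W β) X i) =
      ENNReal.ofReal ((2 / Real.pi) ^ (((m + 1 : ℕ) : ℝ) / 2)) *
        (ENNReal.ofReal (Real.exp (logNorm W 0)) * (φ (ratio (opMatrix W ((2 : ℝ) • β)) X i) *
          ENNReal.ofReal (dens W 0 ((2 : ℝ) • β)))) := fun β => by
    rw [betaDensity_eq hW0, hMatrix_eq_opMatrix hW0, ENNReal.ofReal_mul (by positivity),
      ENNReal.ofReal_mul (by positivity)]
    ring
  rw [hLaw, lintegral_map hmφ (measurable_hMatrix W), betaLaw,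
    lintegral_withDensity_eq_lintegral_mul _ hmd
      (g := fun β => φ (ratio (hMatrix W β) X i)) (hmφ.comp (measurable_hMatrix W))]
  simp only [Pi.mul_apply, hpt]
  rw [lintegral_const_mul' _ _ ENNReal.ofReal_ne_top,
    lintegral_const_mul' _ _ ENNReal.ofReal_ne_top,
    ← lintegral_map (f := fun h => φ (ratio (opMatrix W h) X i) * ENNReal.ofReal (dens W 0 h))
      (g := fun β : Fin (m + 1) → ℝ => (2 : ℝ) • β) hG (by fun_prop),
    Measure.map_addHaar_smul _ (by norm_num), lintegral_smul_measure, smul_eq_mul,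
    mul_left_comm (ENNReal.ofReal (Real.exp _)), lintegral_ratio_mul_dens hW i X hφ, lawConst]
  ring

/-! ### Monotonicity in the weights -/

theorem rooted_of_connected {W : Matrix (Fin (m + 1)) (Fin (m + 1)) ℝ} (hW : W.IsSymm)
    (hnn : ∀ i j, i ≠ j → 0 ≤ W i j) (hconn : ∀ i j, Connected W i j) (i : Fin (m + 1)) :
    Rooted (delWeight W i) (row W i) := by
  intro A hA
  have key : ∀ v, Connected W v i → v ∈ i.succAbove '' A →
      ∃ j ∈ A, 0 < row W i j ∨ ∃ k ∉ A, 0 < delWeight W i j k := by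
    intro v hv
    refine Relation.ReflTransGen.head_induction_on hv ?_ ?_
    · rintro ⟨j, _, hj⟩
      exact absurd hj (Fin.succAbove_ne i j)
    · intro v w hvw _ ih hvA
      by_cases hwA : w ∈ i.succAbove '' A
      · exact ih hwA
      · have hne : v ≠ w := fun h => hwA (h ▸ hvA)
        have hpos : 0 < W v w := lt_of_le_of_ne (hnn v w hne) (Ne.symm hvw)
        obtain ⟨j, hj, rfl⟩ := hvA
        refine ⟨j, hj, ?_⟩
        obtain rfl | ⟨k, rfl⟩ := Fin.eq_self_or_eq_succAbove i w
        · left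
          rw [row, hW.apply]
          exact hpos
        · exact Or.inr ⟨k, fun hk => hwA ⟨k, hk, rfl⟩, hpos⟩
  obtain ⟨j, hj⟩ := hA
  exact key _ (hconn _ i) ⟨j, hj, rfl⟩

/-- The field integral of the ratio at the root `i`, for the graph with weights `W`. -/
def ratioLintegral (W : Matrix (Fin (m + 1)) (Fin (m + 1)) ℝ) (i : Fin (m + 1))
    (X : Fin (m + 1) → ℝ) (φ : ℝ → ℝ≥0∞) : ℝ≥0∞ :=
  fieldLintegral (delWeight W i) (row W i) (X ∘ i.succAbove) (fun z => φ (X i + z))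

/-- Monotonicity in the weight of an arbitrary edge, whether or not it contains the root. -/
theorem ratioLintegral_anti_edge {W W' : Matrix (Fin (m + 1)) (Fin (m + 1)) ℝ} (hW : W.IsSymm)
    (hW' : W'.IsSymm) (hnn : ∀ i j, i ≠ j → 0 ≤ W i j) (i : Fin (m + 1))
    (hr : Rooted (delWeight W i) (row W i)) {a b : Fin (m + 1)} (hab : a ≠ b)
    (hle : W a b ≤ W' a b) (heq : ∀ i j, s(i, j) ≠ s(a, b) → W' i j = W i j)
    {X : Fin (m + 1) → ℝ} (hX : ∀ j, 0 ≤ X j) {f : ℝ → ℝ} (hf : ConvexOn ℝ (Set.Ici 0) f)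
    (hf0 : ∀ z, 0 ≤ z → 0 ≤ f z) (hfm : Measurable f) :
    ratioLintegral W' i X (fun z => ENNReal.ofReal (f z)) ≤
      ratioLintegral W i X (fun z => ENNReal.ofReal (f z)) := by
  have hg : ConvexOn ℝ (Set.Ici 0) fun z => f (X i + z) := by
    simpa using convexOn_comp_add_mul hf (hX i) zero_le_one
  have hg0 : ∀ z, 0 ≤ z → 0 ≤ f (X i + z) := fun z hz => hf0 _ (add_nonneg (hX i) hz)
  have hgm : Measurable fun z => f (X i + z) := by fun_prop
  have hX' : ∀ j, 0 ≤ (X ∘ i.succAbove) j := fun j => hX _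
  have hdW := delWeight_isSymm hW i
  have hdn := delWeight_nonneg hnn i
  have hrow := row_nonneg hnn i
  -- The case in which `i` is an end point of the edge.
  have root : ∀ c : Fin m, W i (i.succAbove c) ≤ W' i (i.succAbove c) →
      (∀ k l, s(k, l) ≠ s(i, i.succAbove c) → W' k l = W k l) →
      ratioLintegral W' i X (fun z => ENNReal.ofReal (f z)) ≤
        ratioLintegral W i X (fun z => ENNReal.ofReal (f z)) := fun c hc hcc => by
    have e : delWeight W' i = delWeight W i := by
      ext k l
      refine hcc _ _ fun h => ?_
      rcases Sym2.eq_iff.1 h with ⟨h, _⟩ | ⟨_, h⟩ <;> exact Fin.succAbove_ne _ _ h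
    rw [ratioLintegral, ratioLintegral, e]
    refine fieldLintegral_anti_root hdW hdn hrow hr c hc (fun j hj => hcc _ _ fun h => ?_) hX' hg
      hg0 hgm
    rcases Sym2.eq_iff.1 h with ⟨_, h⟩ | ⟨_, h⟩
    · exact hj (Fin.succAbove_right_injective h)
    · exact Fin.succAbove_ne _ _ h
  obtain rfl | ⟨a, rfl⟩ := Fin.eq_self_or_eq_succAbove i a
  · obtain ⟨c, rfl⟩ := Fin.exists_succAbove_eq hab.symm
    exact root c hle heq
  obtain rfl | ⟨b, rfl⟩ := Fin.eq_self_or_eq_succAbove i b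
  · refine root a ?_ fun k l h => heq k l fun h' => h (h'.trans Sym2.eq_swap)
    rw [← hW.apply, ← hW'.apply]
    exact hle
  have e : row W' i = row W i := by
    ext l
    refine heq _ _ fun h => ?_
    rcases Sym2.eq_iff.1 h with ⟨h, _⟩ | ⟨h, _⟩ <;> exact Fin.succAbove_ne _ _ h.symm
  rw [ratioLintegral, ratioLintegral, e]
  refine fieldLintegral_anti_edge hdW (delWeight_isSymm hW' i) hdn hrow hr
    (fun h => hab (congrArg _ h)) hle (fun k l h => heq _ _ fun h' => h ?_) hX' hg hg0 hgm
  have hinj := Fin.succAbove_right_injective (p := i)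
  rcases Sym2.eq_iff.1 h' with ⟨h1, h2⟩ | ⟨h1, h2⟩
  · exact Sym2.eq_iff.2 (Or.inl ⟨hinj h1, hinj h2⟩)
  · exact Sym2.eq_iff.2 (Or.inr ⟨hinj h1, hinj h2⟩)

/-- Monotonicity in all weights, by raising one edge weight after the other. -/
theorem ratioLintegral_anti {W W' : Matrix (Fin (m + 1)) (Fin (m + 1)) ℝ} (hW : W.IsSymm)
    (hW' : W'.IsSymm) (hd : ∀ i, W i i = 0) (hd' : ∀ i, W' i i = 0)
    (hnn : ∀ i j, i ≠ j → 0 ≤ W i j) (hle : ∀ i j, W i j ≤ W' i j) (i : Fin (m + 1))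
    (hr : Rooted (delWeight W i) (row W i))
    {X : Fin (m + 1) → ℝ} (hX : ∀ j, 0 ≤ X j) {f : ℝ → ℝ} (hf : ConvexOn ℝ (Set.Ici 0) f)
    (hf0 : ∀ z, 0 ≤ z → 0 ≤ f z) (hfm : Measurable f) :
    ratioLintegral W' i X (fun z => ENNReal.ofReal (f z)) ≤
      ratioLintegral W i X (fun z => ENNReal.ofReal (f z)) := by
  classical
  let V : Finset (Sym2 (Fin (m + 1))) → Matrix (Fin (m + 1)) (Fin (m + 1)) ℝ := fun s =>
    Matrix.of fun k l => if s(k, l) ∈ s then W' k l else W k l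
  have hV : ∀ s, (V s).IsSymm := fun s => by
    ext k l
    simp only [V, Matrix.transpose_apply, Matrix.of_apply, Sym2.eq_swap (a := l), hW.apply,
      hW'.apply]
  have hVle : ∀ s k l, W k l ≤ V s k l := fun s k l => by
    simp only [V, Matrix.of_apply]
    split_ifs
    · exact hle k l
    · exact le_rfl
  have main : ∀ s, ratioLintegral (V s) i X (fun z => ENNReal.ofReal (f z)) ≤
      ratioLintegral W i X (fun z => ENNReal.ofReal (f z)) := by
    intro s
    induction s using Finset.induction_on with
    | empty =>
      have : V ∅ = W := by ext k l; simp [V]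
      rw [this]
    | insert e s he ih =>
      refine le_trans ?_ ih
      induction e using Sym2.ind with
      | _ a b =>
        by_cases hab : a = b
        · have : V (insert s(a, b) s) = V s := by
            ext k l
            simp only [V, Matrix.of_apply, Finset.mem_insert]
            by_cases h : s(k, l) = s(a, b)
            · have hkl : k = l := by
                rcases Sym2.eq_iff.1 h with ⟨h1, h2⟩ | ⟨h1, h2⟩ <;> rw [h1, h2, hab]
              subst hkl
              simp [hd, hd']
            · simp [h]
          rw [this]
        · refine ratioLintegral_anti_edge (hV s) (hV _)
            (fun k l hkl => (hnn k l hkl).trans (hVle s k l)) i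
            (hr.mono (fun k l => hVle s _ _) (fun l => hVle s _ _)) hab ?_ ?_ hX hf hf0 hfm
          · simp only [V, Matrix.of_apply, Finset.mem_insert, true_or, if_true, he, if_false]
            exact hle a b
          · intro k l hkl
            simp only [V, Matrix.of_apply, Finset.mem_insert, hkl, false_or]
  have huniv : V Finset.univ = W' := by ext k l; simp [V]
  rw [← huniv]
  exact main _

/-! ### Convex functions of either sign -/

theorem exists_affine_lower_bound {f : ℝ → ℝ} (hf : ConvexOn ℝ (Set.Ici 0) f) :
    ∃ M : ℝ, 0 ≤ M ∧ ∀ z, 0 ≤ z → 0 ≤ f z + M * (1 + z) := by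
  refine ⟨|f 1| + |f 1 - f 0| + |f 2 - f 1|, by positivity, fun z hz => ?_⟩
  have h0 : (0 : ℝ) ∈ Set.Ici (0 : ℝ) := Set.self_mem_Ici
  have a1 := neg_abs_le (f 1)
  have a2 := neg_abs_le (f 1 - f 0)
  have a3 := le_abs_self (f 2 - f 1)
  have p1 := abs_nonneg (f 1)
  have p2 := abs_nonneg (f 1 - f 0)
  have p3 := abs_nonneg (f 2 - f 1)
  rcases lt_trichotomy z 1 with h | rfl | h
  · have hs := hf.slope_mono_adjacent (Set.mem_Ici.2 hz) (show (2 : ℝ) ∈ Set.Ici 0 by simp) h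
      one_lt_two
    rw [div_le_div_iff₀ (by linarith) (by norm_num)] at hs
    nlinarith [mul_nonneg p1 hz, mul_nonneg p2 hz, mul_nonneg p3 hz]
  · nlinarith
  · have hs := hf.slope_mono_adjacent h0 (Set.mem_Ici.2 hz) one_pos h
    rw [div_le_div_iff₀ (by norm_num) (by linarith)] at hs
    nlinarith [mul_nonneg p1 hz, mul_nonneg p2 hz, mul_nonneg p3 hz]

/-- A convex function on `[0, ∞)` need not be continuous at `0`, but it is still measurable. -/
theorem exists_measurable_eqOn {f : ℝ → ℝ} (hf : ConvexOn ℝ (Set.Ici 0) f) :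
    ∃ g : ℝ → ℝ, Measurable g ∧ Set.EqOn f g (Set.Ici 0) := by
  classical
  have hc : ContinuousOn f (Set.Ioi 0) :=
    (hf.subset Set.Ioi_subset_Ici_self (convex_Ioi 0)).continuousOn isOpen_Ioi
  refine ⟨(Set.Ioi (0 : ℝ)).piecewise f fun _ => f 0,
    hc.measurable_piecewise continuousOn_const measurableSet_Ioi, fun z hz => ?_⟩
  rcases (Set.mem_Ici.1 hz).eq_or_lt with h | h
  · subst h; simp
  · rw [Set.piecewise_eq_of_mem _ _ _ (Set.mem_Ioi.2 h)]

theorem ereal_sub_eq_sub {a n q t : ℝ≥0∞} (hn : n ≠ ∞) (ht : t ≠ ∞) (h : a + t = q + n) :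
    (a : EReal) - (n : EReal) = (q : EReal) - (t : EReal) := by
  lift n to NNReal using hn
  lift t to NNReal using ht
  by_cases ha : a = ∞
  · have hq : q = ∞ := by
      rw [ha, top_add] at h
      by_contra hq
      exact (ENNReal.add_ne_top.2 ⟨hq, ENNReal.coe_ne_top⟩) h.symm
    rw [ha, hq]
    rfl
  · have hq : q ≠ ∞ := fun hq => by
      rw [hq, top_add] at h
      exact (ENNReal.add_ne_top.2 ⟨ha, ENNReal.coe_ne_top⟩) h
    lift a to NNReal using ha
    lift q to NNReal using hq
    have h' : (a : ℝ) + t = q + n := by exact_mod_cast h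
    have h2 : (a : ℝ) - n = q - t := by linarith
    have h3 : (((a : ℝ) - n : ℝ) : EReal) = (((q : ℝ) - t : ℝ) : EReal) := by rw [h2]
    rw [EReal.coe_sub, EReal.coe_sub] at h3
    exact h3

/-- If `M (1 + Z)` is integrable and `f + M (1 + ·)` is nonnegative, the expectation of `f Z` exists
and is the difference of the integrals of `f Z + M (1 + Z)` and `M (1 + Z)`. -/
theorem hasExpectation_and_expectation_eq {Ω : Type*} [MeasurableSpace Ω] {P : Measure Ω}
    {Z : Ω → ℝ} (hZ : AEMeasurable Z P) (hZ0 : ∀ᵐ ω ∂P, 0 ≤ Z ω) {f g : ℝ → ℝ} (hg : Measurable g)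
    (hfg : Set.EqOn f g (Set.Ici 0)) {M : ℝ} (hM : 0 ≤ M)
    (hfM : ∀ z, 0 ≤ z → 0 ≤ g z + M * (1 + z))
    (hT : ∫⁻ ω, ENNReal.ofReal (M + M * Z ω) ∂P ≠ ∞) :
    HasExpectation P (fun ω => f (Z ω)) ∧
      expectation P (fun ω => f (Z ω)) =
        ((∫⁻ ω, ENNReal.ofReal (g (Z ω) + M * (1 + Z ω)) ∂P : ℝ≥0∞) : EReal) -
          ((∫⁻ ω, ENNReal.ofReal (M + M * Z ω) ∂P : ℝ≥0∞) : EReal) := by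
  have hae : (fun ω => f (Z ω)) =ᵐ[P] fun ω => g (Z ω) := by
    filter_upwards [hZ0] with ω hω using hfg hω
  have hgZ : AEMeasurable (fun ω => g (Z ω)) P := hg.comp_aemeasurable hZ
  have hfZ : AEMeasurable (fun ω => f (Z ω)) P := hgZ.congr hae.symm
  have hneg : ∫⁻ ω, ENNReal.ofReal (-f (Z ω)) ∂P ≠ ∞ := by
    refine ne_top_of_le_ne_top hT (lintegral_mono_ae ?_)
    filter_upwards [hZ0, hae] with ω hω he
    refine ENNReal.ofReal_le_ofReal ?_
    have := hfM _ hω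
    rw [he]
    linarith
  refine ⟨⟨hfZ, hneg⟩, ereal_sub_eq_sub hneg hT ?_⟩
  have hm1 : AEMeasurable (fun ω => ENNReal.ofReal (M + M * Z ω)) P := by fun_prop
  have hm2 : AEMeasurable (fun ω => ENNReal.ofReal (-f (Z ω))) P := hfZ.neg.ennreal_ofReal
  rw [← lintegral_add_right' _ hm1, ← lintegral_add_right' _ hm2]
  refine lintegral_congr_ae ?_
  filter_upwards [hZ0, hae] with ω hω he
  have hp := hfM _ hω
  have hMZ : 0 ≤ M + M * Z ω := by positivity
  rw [he]
  rcases le_total 0 (g (Z ω)) with h | h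
  · rw [ENNReal.ofReal_of_nonpos (neg_nonpos.2 h), add_zero, ← ENNReal.ofReal_add h hMZ]
    congr 1; ring
  · rw [ENNReal.ofReal_of_nonpos h, zero_add, ← ENNReal.ofReal_add hp (neg_nonneg.2 h)]
    congr 1; ring

theorem ae_ratio_nonneg {W : Matrix (Fin (m + 1)) (Fin (m + 1)) ℝ} (hW : W.IsSymm)
    (hd : ∀ i, W i i = 0) (hnn : ∀ i j, i ≠ j → 0 ≤ W i j) (i : Fin (m + 1))
    {X : Fin (m + 1) → ℝ} (hX : ∀ j, 0 ≤ X j) : ∀ᵐ H ∂(hLaw W 0), 0 ≤ ratio H X i := by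
  let φ : ℝ → ℝ≥0∞ := (Set.Iio (0 : ℝ)).indicator 1
  have hφ : Measurable φ := measurable_one.indicator measurableSet_Iio
  have h := lintegral_hLaw_eq hW hd i X hφ
  have h0 : fieldLintegral (delWeight W i) (row W i) (X ∘ i.succAbove) (fun z => φ (X i + z)) =
      0 := by
    have : ∀ h, φ (X i + green (delWeight W i) h (X ∘ i.succAbove) (row W i)) *
        ENNReal.ofReal (dens (delWeight W i) (row W i) h) = 0 := fun h => by
      by_cases hpd : (opMatrix (delWeight W i) h).PosDef
      · have hg := green_nonneg (delWeight_isSymm hW i) (delWeight_nonneg hnn i) hpd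
          (X := X ∘ i.succAbove) (fun j => hX _) (row_nonneg hnn i)
        have : X i + green (delWeight W i) h (X ∘ i.succAbove) (row W i) ∉ Set.Iio (0 : ℝ) := by
          simpa using add_nonneg (hX i) hg
        simp only [φ]
        rw [Set.indicator_of_notMem this, zero_mul]
      · simp [dens, hpd]
    rw [fieldLintegral]
    simp only [this]
    simp
  rw [h0, mul_zero, lintegral_eq_zero_iff
    (f := fun H => φ (ratio H X i)) (hφ.comp (measurable_ratio X i))] at h
  filter_upwards [h] with H hH
  by_contra hc
  simp [φ, not_le.1 hc] at hH

/-- The expectation of a convex function of the ratio, as the difference of the field integral of a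
nonnegative convex function and a finite constant which does not depend on the weights. -/
theorem expectation_ratio {Ω : Type*} [MeasurableSpace Ω] {P : Measure Ω}
    {W : Matrix (Fin (m + 1)) (Fin (m + 1)) ℝ} {H : Ω → Matrix (Fin (m + 1)) (Fin (m + 1)) ℝ}
    (hH : HasLaw H (hLaw W 0) P) (hW : W.IsSymm) (hd : ∀ i, W i i = 0)
    (hnn : ∀ i j, i ≠ j → 0 ≤ W i j) {i : Fin (m + 1)} (hr : Rooted (delWeight W i) (row W i))
    {X : Fin (m + 1) → ℝ} (hX : ∀ j, 0 ≤ X j) {f g : ℝ → ℝ} (hg : Measurable g)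
    (hfg : Set.EqOn f g (Set.Ici 0)) {M : ℝ} (hM : 0 ≤ M)
    (hgM : ∀ z, 0 ≤ z → 0 ≤ g z + M * (1 + z)) :
    HasExpectation P (fun ω => f (ratio (H ω) X i)) ∧
      expectation P (fun ω => f (ratio (H ω) X i)) =
        ((lawConst m * ratioLintegral W i X (fun z => ENNReal.ofReal (g z + M * (1 + z))) : ℝ≥0∞) :
            EReal) -
          ((lawConst m * (ENNReal.ofReal (M + M * X i + M * ∑ j, (X ∘ i.succAbove) j) *
            ENNReal.ofReal (Real.sqrt (2 * Real.pi)) ^ m) : ℝ≥0∞) : EReal) := by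
  have transfer : ∀ {φ : ℝ → ℝ≥0∞}, Measurable φ →
      ∫⁻ ω, φ (ratio (H ω) X i) ∂P = lawConst m * ratioLintegral W i X φ := fun {φ} hφ => by
    rw [ratioLintegral, ← lintegral_hLaw_eq hW hd i X hφ, ← hH.map_eq,
      lintegral_map' (f := fun H => φ (ratio H X i)) (hφ.comp (measurable_ratio X i)).aemeasurable
        hH.aemeasurable]
  have hT : ratioLintegral W i X (fun z => ENNReal.ofReal (M + M * z)) =
      ENNReal.ofReal (M + M * X i + M * ∑ j, (X ∘ i.succAbove) j) *
        ENNReal.ofReal (Real.sqrt (2 * Real.pi)) ^ m := by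
    have e : (fun z : ℝ => ENNReal.ofReal (M + M * (X i + z))) =
        fun z => ENNReal.ofReal (M + M * X i + M * z) := by
      ext z; congr 1; ring
    rw [ratioLintegral, e, fieldLintegral_affine (delWeight_isSymm hW i)
      (delWeight_nonneg hnn i) (row_nonneg hnn i) hr
      (X := X ∘ i.succAbove) (fun j => hX _)
      (add_nonneg hM (mul_nonneg hM (hX i))) hM]
  have h0 : ∀ᵐ ω ∂P, 0 ≤ ratio (H ω) X i := by
    have := ae_ratio_nonneg hW hd hnn i hX
    rw [← hH.map_eq] at this
    exact ae_of_ae_map hH.aemeasurable this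
  rw [← hT, ← transfer (by fun_prop), ← transfer (by fun_prop)]
  refine hasExpectation_and_expectation_eq (Z := fun ω => ratio (H ω) X i)
    ((measurable_ratio X i).comp_aemeasurable hH.aemeasurable) h0 hg hfg hM hgM ?_
  rw [transfer (φ := fun z => ENNReal.ofReal (M + M * z)) (by fun_prop), hT]
  have := lawConst_ne_top m
  finiteness

end BetaField

end

open BetaField

theorem theorem6 (n : ℕ) (hn : 2 ≤ n) (Wm Wp : Matrix (Fin n) (Fin n) ℝ)
    (hWm_symm : Wm.IsSymm) (hWp_symm : Wp.IsSymm)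
    (hWm_diag : ∀ i, Wm i i = 0) (hWp_diag : ∀ i, Wp i i = 0)
    (hWm_nonneg : ∀ i j, i ≠ j → 0 ≤ Wm i j) (hWp_nonneg : ∀ i j, i ≠ j → 0 ≤ Wp i j)
    (hle : ∀ i j, Wm i j ≤ Wp i j)
    (hconn : ∀ i j, BetaField.Connected Wm i j)
    {Ωm Ωp : Type*} [MeasurableSpace Ωm] [MeasurableSpace Ωp]
    (Pm : MeasureTheory.Measure Ωm) (Pp : MeasureTheory.Measure Ωp)
    (Hm : Ωm → Matrix (Fin n) (Fin n) ℝ) (Hp : Ωp → Matrix (Fin n) (Fin n) ℝ)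
    (hHm : ProbabilityTheory.HasLaw Hm (BetaField.hLaw Wm 0) Pm)
    (hHp : ProbabilityTheory.HasLaw Hp (BetaField.hLaw Wp 0) Pp)
    (f : ℝ → ℝ) (hf : ConvexOn ℝ (Set.Ici 0) f)
    (i : Fin n) (X : Fin n → ℝ) (hX : ∀ j, 0 ≤ X j) :
    BetaField.HasExpectation Pm (fun ω => f (BetaField.ratio (Hm ω) X i)) ∧
    BetaField.HasExpectation Pp (fun ω => f (BetaField.ratio (Hp ω) X i)) ∧
    BetaField.expectation Pp (fun ω => f (BetaField.ratio (Hp ω) X i)) ≤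
      BetaField.expectation Pm (fun ω => f (BetaField.ratio (Hm ω) X i)) := by
  obtain _ | m := n
  · exact i.elim0
  obtain ⟨M, hM, hfM⟩ := exists_affine_lower_bound hf
  obtain ⟨g, hg, hfg⟩ := exists_measurable_eqOn hf
  have hrm := rooted_of_connected hWm_symm hWm_nonneg hconn i
  have hrp : Rooted (delWeight Wp i) (row Wp i) := hrm.mono (fun _ _ => hle _ _) fun _ => hle _ _
  have hgM : ∀ z, 0 ≤ z → 0 ≤ g z + M * (1 + z) := fun z hz => hfg hz ▸ hfM z hz
  have hgc : ConvexOn ℝ (Set.Ici 0) fun z => g z + M * (1 + z) := by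
    have h2 : ConvexOn ℝ (Set.Ici (0 : ℝ)) fun z : ℝ => M * (1 + z) :=
      ((convexOn_const (1 : ℝ) (convex_Ici 0)).add (convexOn_id (convex_Ici 0))).smul hM
    exact (hf.congr hfg).add h2
  obtain ⟨em, eqm⟩ := expectation_ratio hHm hWm_symm hWm_diag hWm_nonneg hrm hX hg hfg hM hgM
  obtain ⟨ep, eqp⟩ := expectation_ratio hHp hWp_symm hWp_diag hWp_nonneg hrp hX hg hfg hM hgM
  refine ⟨em, ep, ?_⟩
  rw [eqm, eqp]
  refine EReal.sub_le_sub (EReal.coe_ennreal_le_coe_ennreal_iff.2 ?_) le_rfl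
  gcongr _ * ?_
  exact ratioLintegral_anti hWm_symm hWp_symm hWm_diag hWp_diag hWm_nonneg hle i hrm hX hgc hgM
    (by fun_prop)
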